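/- A *problem* is a partial multifunction $\mathsf P:\subseteq\omega^\omega\rightrightarrows\omega^\omega$; the elements of $\operatorname{dom}(\mathsf P)$ are its instances and the elements of $\mathsf P(f)$ the solutions to the instance $f$. A number $x$ is identified with $(x,0,0,\dots)\in\omega^\omega$, a set with its characteristic function, and $\langle\cdot,\cdot\rangle$ denotes the Turing join. Write $\mathsf Q\le_{\mathrm W}\mathsf P$ if there are Turing functionals $\Phi,\Psi$ such that for every $\mathsf Q$-instance $f$, $\Phi(f)$ is a $\mathsf P$-instance and $\Psi(\langle f,g\rangle)\in\mathsf Q(f)$ for every $g\in\mathsf P(\Phi(f))$. * The *first-order part* ${}^1\mathsf P$ has as instances all $\langle f,\Phi,\Psi\rangle$ ($f\in\omega^\omega$; $\Phi,\Psi$ indices of Turing functionals) such that $\Phi(f)\in\operatorname{dom}(\mathsf P)$ and $\Psi(\langle f,g\rangle)(0)$ converges for all $g\in\mathsf P(\Phi(f))$; the solutions are all numbers $\Psi(\langle f,g\rangle)(0)$ with $g\in\mathsf P(\Phi(f))$. * $\mathsf P^*$ has as instances all $\langle k,\langle f_0,\dots,f_{k-1}\rangle\rangle$ with $k\ge 1$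 and all $f_i$ instances of $\mathsf P$; the solutions are the tuples $\langle k,\langle g_0,\dots,g_{k-1}\rangle\rangle$ with $g_i\in\mathsf P(f_i)$ for all $i<k$ (so the length can be read off from a solution). * The *jump* $\mathsf P'$ has as instances all $\langle f,i\rangle$ such that $i$ is a $\Delta^{0,f}_2$ index for a $\mathsf P$-instance $g$, that is, $\Phi_i(f)$ is total and $\lim_s\Phi_i(f)(\langle x,s\rangle)=g(x)$ for all $x$; the solutions are the $\mathsf P$-solutions to $g$. Put $\mathsf P^{(0)}=\mathsf P$, $\mathsf P^{(n+1)}=(\mathsf P^{(n)})'$. * $\mathsf C_2$ has as instances the enumerations $v:\omega\to 3$ of proper subsets of $\{0,1\}$ (the value $2$ means that nothing has been enumerated yet, and an enumerated number is repeated from then on); the solutions are the $i<2$ that are not enumerated. * For $n,k\ge1$, $\mathsf{RT}^n_k$ has as instances the colorings $c:[\omega]^n\to k$, where $[\omega]^n$ is the set of strictly increasing $n$-tuples; the solutions are the infinite sets $H$ such that $c$ is constant on $[H]^n$. $\mathsf{SRT}^n_k$ is its restriction to *stable* colorings, those for which $\lim_s c(\vec x,s)$ exists for all $\vec x\in[\omega]^{n-1}$.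 Further, $\mathsf{RT}^n_{\mathbb N}=\bigcup_{k\ge1}\mathsf{RT}^n_k$ (the number $k$ is not part of the instance) and $\mathsf{RT}^n_+=\bigsqcup_{k\ge2}\mathsf{RT}^n_k$ (instances $\langle k,c\rangle$ with $c$ an instance of $\mathsf{RT}^n_k$, solutions $\langle k,H\rangle$ with $H\in\mathsf{RT}^n_k(c)$); similarly for $\mathsf{SRT}^n_{\mathbb N}$ and $\mathsf{SRT}^n_+$. **Theorem.** For all $n\ge 2$, $$(\mathsf C_2^{(n)})^*\le_{\mathrm W}{}^1\mathsf{SRT}^n_{\mathbb N}\le_{\mathrm W}{}^1\mathsf{RT}^n_{\mathbb N}\le_{\mathrm W}(\mathsf C_2^*)^{(n)} \quad\text{and}\quad (\mathsf C_2^{(n)})^*\le_{\mathrm W}{}^1\mathsf{SRT}^n_{+}\le_{\mathrm W}{}^1\mathsf{RT}^n_{+}\le_{\mathrm W}(\mathsf C_2^*)^{(n)}.$$ For $n=1$, all of these reductions hold except that $(\mathsf C_2')^*$ is bounded by the non-stable problems: $$(\mathsf C_2')^*\le_{\mathrm W}{}^1\mathsf{RT}^1_{\mathbb N}\le_{\mathrm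 W}(\mathsf C_2^*)',\quad {}^1\mathsf{SRT}^1_{\mathbb N}\le_{\mathrm W}{}^1\mathsf{RT}^1_{\mathbb N},\quad (\mathsf C_2')^*\le_{\mathrm W}{}^1\mathsf{RT}^1_{+}\le_{\mathrm W}(\mathsf C_2^*)',\quad {}^1\mathsf{SRT}^1_{+}\le_{\mathrm W}{}^1\mathsf{RT}^1_{+}.$$ -/

import Mathlib

namespace Weihrauch

/-- Baire space `ω^ω`. -/
abbrev Baire : Type := ℕ → ℕ

/-! ### Turing functionals

The `e`-th Turing functional `Φ_e` runs the `e`-th partial computable function on pairs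
`(σ, x)`, where `σ` is a finite initial segment of the oracle and `x` is the argument;
`Φ_e(f)(x)` is the first output found in a search through all initial segments of `f`
and all step bounds. -/

/-- A number coding the initial segment `(f 0, …, f (s - 1))` of `f`. -/
def initSeg (f : Baire) (s : ℕ) : ℕ :=
  Encodable.encode ((List.range s).map f)

/-- The value `Φ_e(f)(x)` of the `e`-th Turing functional, possibly undefined.
In the search parameter `t = ⟨s, k⟩`, the number `s` is the length of the initial segment of the
oracle that may be used and `k` is the bound on the computation. -/
def functional (e : ℕ) (f : Baire) (x : ℕ) : Part ℕ :=
  Nat.rfindOpt fun t =>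
    Nat.Partrec.Code.evaln t.unpair.2 (Denumerable.ofNat Nat.Partrec.Code e)
      (Nat.pair (initSeg f t.unpair.1) x)

/-- `Φ_e(f) = g`, that is, `Φ_e(f)(x)` converges to `g x` for all `x`. -/
def Computes (e : ℕ) (f g : Baire) : Prop :=
  ∀ x, g x ∈ functional e f x

/-! ### Coding -/

/-- The embedding of `ω` into `ω^ω`: the number `x` is identified with `(x, 0, 0, …)`. -/
def ofNum (x : ℕ) : Baire := fun n => if n = 0 then x else 0

/-- The join `⟨f, g⟩`, with `f` on the even and `g` on the odd numbers. -/
def join (f g : Baire) : Baire := fun n => if n % 2 = 0 then f (n / 2) else g (n / 2)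

/-- The join `⟨k, ⟨f_0, …, f_{k-1}⟩⟩` of finitely many functions, with their number on record. -/
def finJoin (k : ℕ) (fs : Fin k → Baire) : Baire :=
  join (ofNum k) fun n => if h : n.unpair.1 < k then fs ⟨n.unpair.1, h⟩ n.unpair.2 else 0

open Classical in
/-- The characteristic function of a set of natural numbers. -/
noncomputable def charFn (H : Set ℕ) : Baire := fun x => if x ∈ H then 1 else 0

/-! ### Problems and operations on them -/

/-- A problem: a set of instances and, for each instance `f`, the set `sol f` of its solutions.
The values of `sol` outside `dom` play no role. -/
structure Problem where
  /-- the set of instances -/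
  dom : Set Baire
  /-- the set of solutions to an instance -/
  sol : Baire → Set Baire

/-- `Q ≤_W P`: Weihrauch reducibility. -/
def WeihrauchLE (Q P : Problem) : Prop :=
  ∃ Φ Ψ : ℕ, ∀ f ∈ Q.dom, ∃ p ∈ P.dom, Computes Φ f p ∧
    ∀ g ∈ P.sol p, ∃ q ∈ Q.sol f, Computes Ψ (join f g) q

namespace Problem

/-- The finite parallelization `P*`: its instances are the `⟨k, ⟨f_0, …, f_{k-1}⟩⟩` with `k ≥ 1`
and all `f_i` instances of `P`, its solutions the tuples of solutions. -/
def star (P : Problem) : Problem where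
  dom := {h | ∃ k, 1 ≤ k ∧ ∃ fs : Fin k → Baire, (∀ i, fs i ∈ P.dom) ∧ h = finJoin k fs}
  sol h := {g | ∃ k, 1 ≤ k ∧ ∃ fs : Fin k → Baire, h = finJoin k fs ∧
    ∃ gs : Fin k → Baire, (∀ i, gs i ∈ P.sol (fs i)) ∧ g = finJoin k gs}

/-- `i` is a `Δ^0_2` index relative to `f` for `g`: the functional `Φ_i(f)` is total and, as a
function of a pair `⟨x, s⟩`, converges to `g x` as `s → ∞`. -/
def IsDelta2Index (f : Baire) (i : ℕ) (g : Baire) : Prop :=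
  ∃ a : Baire, Computes i f a ∧ ∀ x, ∀ᶠ s in Filter.atTop, a (Nat.pair x s) = g x

/-- The jump `P'`: its instances are the `⟨f, i⟩` such that `i` is a `Δ^0_2` index relative
to `f` for an instance `g` of `P`, its solutions are the `P`-solutions to `g`. -/
def jump (P : Problem) : Problem where
  dom := {h | ∃ f i, h = join f (ofNum i) ∧ ∃ g ∈ P.dom, IsDelta2Index f i g}
  sol h := {y | ∃ f i, h = join f (ofNum i) ∧ ∃ g ∈ P.dom, IsDelta2Index f i g ∧ y ∈ P.sol g}

/-- The `n`-th jump `P^(n)`. -/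
def iterJump (P : Problem) : ℕ → Problem
  | 0 => P
  | n + 1 => (iterJump P n).jump

/-- The first-order part `¹P`: its instances are the triples `⟨f, Φ, Ψ⟩` such that `Φ(f)` is an
instance of `P` and `Ψ(f, g)(0)` converges for every `P`-solution `g` to `Φ(f)`; its solutions
are the numbers `y = Ψ(f, g)(0)` for such `g`. -/
def firstOrderPart (P : Problem) : Problem where
  dom := {h | ∃ f Φ Ψ, h = join f (join (ofNum Φ) (ofNum Ψ)) ∧
    ∃ p ∈ P.dom, Computes Φ f p ∧ ∀ g ∈ P.sol p, (functional Ψ (join f g) 0).Dom}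
  sol h := {z | ∃ f Φ Ψ, h = join f (join (ofNum Φ) (ofNum Ψ)) ∧
    ∃ p ∈ P.dom, Computes Φ f p ∧ ∃ g ∈ P.sol p, ∃ y ∈ functional Ψ (join f g) 0, z = ofNum y}

/-- The join `⨆_{k ≥ m} P_k`: instances are the `⟨k, f⟩` with `k ≥ m` and `f` an instance
of `P_k`, solutions are the `⟨k, g⟩` with `g` a `P_k`-solution to `f`. -/
def joinFrom (m : ℕ) (P : ℕ → Problem) : Problem where
  dom := {h | ∃ k, m ≤ k ∧ ∃ f ∈ (P k).dom, h = join (ofNum k) f}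
  sol h := {y | ∃ k, m ≤ k ∧ ∃ f ∈ (P k).dom, h = join (ofNum k) f ∧
    ∃ g ∈ (P k).sol f, y = join (ofNum k) g}

/-- The union `⋃_{k ≥ m} P_k` of problems as multifunctions: here `k` is not part of the
instance. -/
def unionFrom (m : ℕ) (P : ℕ → Problem) : Problem where
  dom := {f | ∃ k, m ≤ k ∧ f ∈ (P k).dom}
  sol f := {g | ∃ k, m ≤ k ∧ f ∈ (P k).dom ∧ g ∈ (P k).sol f}

end Problem

/-! ### Choice -/

/-- The choice problem `C_k` for finite `k`. An instance is a function `v : ω → k + 1` that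
enumerates a proper subset of `k = {0, …, k - 1}`: the value `k` means that nothing has been
enumerated yet, and each enumerated number is repeated until the next one appears.
The solutions are the `i < k` that are not enumerated. -/
def C (k : ℕ) : Problem where
  dom := {v | (∀ s, v s < k + 1) ∧ (∃ i < k, i ∉ Set.range v) ∧
    (∀ s t, s < t → v s ≠ v t → v t ≠ k) ∧
    (∀ s u t, s < u → u < t → v s = v t → v s = v u)}
  sol v := {y | ∃ i < k, i ∉ Set.range v ∧ y = ofNum i}

/-! ### Ramsey's theorem -/

/-- `[X]^n`: the strictly increasing `n`-tuples of elements of `X`. -/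
def tuples (X : Set ℕ) (n : ℕ) : Set (List ℕ) :=
  {l | l.length = n ∧ l.Pairwise (· < ·) ∧ ∀ x ∈ l, x ∈ X}

/-- The color of the tuple `l` under the coloring that `c ∈ ω^ω` stands for. -/
def color (c : Baire) (l : List ℕ) : ℕ := c (Encodable.encode l)

/-- `c` stands for a `k`-coloring of `[ω]^n`. -/
def IsColoring (n k : ℕ) (c : Baire) : Prop :=
  ∀ l ∈ tuples Set.univ n, color c l < k

/-- The coloring `c` of `[ω]^n` (`n ≥ 1`) is stable: `lim_s c(x, s)` exists for all
`x ∈ [ω]^(n-1)`. -/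
def IsStable (n : ℕ) (c : Baire) : Prop :=
  ∀ l ∈ tuples Set.univ (n - 1), ∃ i, ∀ᶠ s in Filter.atTop, color c (l ++ [s]) = i

/-- `Y` is homogeneous for the coloring `c` of `[ω]^n`. -/
def IsHomogeneous (n : ℕ) (c : Baire) (Y : Set ℕ) : Prop :=
  ∃ i, ∀ l ∈ tuples Y n, color c l = i

/-- `RT^n_k`. -/
def RT (n k : ℕ) : Problem where
  dom := {c | IsColoring n k c}
  sol c := {g | ∃ H : Set ℕ, H.Infinite ∧ IsHomogeneous n c H ∧ g = charFn H}

/-- `SRT^n_k`: the restriction of `RT^n_k` to stable colorings. -/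
def SRT (n k : ℕ) : Problem where
  dom := {c | IsColoring n k c ∧ IsStable n c}
  sol := (RT n k).sol

/-- `RT^n_+`. -/
def RTPlus (n : ℕ) : Problem := Problem.joinFrom 2 (RT n)

/-- `SRT^n_+`. -/
def SRTPlus (n : ℕ) : Problem := Problem.joinFrom 2 (SRT n)

/-- `RT^n_ℕ`. -/
def RTNat (n : ℕ) : Problem := Problem.unionFrom 1 (RT n)

/-- `SRT^n_ℕ`. -/
def SRTNat (n : ℕ) : Problem := Problem.unionFrom 1 (SRT n)

end Weihrauch

/-! Upper bound. Let `f` be the oracle, `p = Φ(f)` a coloring of `n`-tuples and `Ψ` the functional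
whose value at `0` is wanted. It suffices to find, computably in the `n`-th jump of `f`, a bound `b`
and an enumeration of the complement of a nonempty set of numbers `≤ b`, each of which is the value
of `Ψ` on some infinite homogeneous set (`exists_candidateSet`).

For `n = 1`, the jump bounds the colors and finds for each color a finite segment of that color on
which `Ψ` already converges, if there is one. The value found is correct whenever the color occurs
infinitely often, since the segment then extends to an infinite set of the same color; a color that
stops occurring is eventually recognized by the jump.

The induction step uses an infinite set `A` on which the color of a tuple does not depend on its
last element, and such that the jump of `f ⊕ A` is computable in `f''` (`exists_prehomogeneous`).
Passing to `A` lowers the exponent by one at the cost of one jump. The set `A` is a limit of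
branches of an Erdős–Rado tree. Conditions inherited by subbranches, namely "`z` is not on the
branch" and "the `e`-th computation does not converge on the branch", are accepted greedily whenever
infinitely many branches satisfy them together with those accepted before. Each decision is a single
question to `f''`, and the decisions determine both `A` and the jump.

A member of the candidate set is then selected by `b + 1` parallel instances of `C 2`: which of
`{m}` and `{m + 1, …, b}` is exhausted first (`candidate_of_choice`)? By the limit lemma these
instances, computable in the `n`-th jump, form one instance of the `n`-th jump of `(C 2).star`
(`exists_iterJump`).

Lower bound. An instance of the `n`-th jump of `C 2` is an `n`-fold iterated limit of values `a(y;
s₁, …, sₙ)` (`exists_iterated_limit`). For each of `k` given instances, the color of `(s₁, …, sₙ)`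
records a number different from the first one that the approximation enumerates at some `y ≤ s₁`.
Any infinite set contains tuples, chosen large enough coordinate by coordinate, that see the true
enumerations up to a given point; hence the color of an infinite homogeneous set solves all `k`
instances, and it can be read from a single tuple (`exists_coloring`). For `n ≥ 2` the first
coordinate stays fixed while the last one grows, and the innermost limit always exists, so the
coloring is stable. For `n = 1` the first coordinate is also the last, and this argument for
stability is not available.

The remaining reductions compare the Ramsey problems directly and pass to first-order parts by
`firstOrderPart_mono`. -/

namespace Weihrauch

/-! ### Initial segments and monotone approximations -/

/-- The initial segment of `f` of length `s`. -/
def pre (f : Baire) (s : ℕ) : List ℕ := (List.range s).map f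

@[simp] lemma length_pre (f : Baire) (s : ℕ) : (pre f s).length = s := by simp [pre]

lemma pre_succ (f : Baire) (s : ℕ) : pre f (s + 1) = pre f s ++ [f s] := by
  simp [pre, List.range_succ]

lemma getElem?_pre {f : Baire} {s i : ℕ} (h : i < s) : (pre f s)[i]? = some (f i) := by
  simp [pre, h]

lemma pre_prefix {f : Baire} {s t : ℕ} (h : s ≤ t) : pre f s <+: pre f t := by
  induction h with
  | refl => exact List.prefix_rfl
  | step _ ih => rw [pre_succ]; exact ih.trans (List.prefix_append _ _)

lemma pre_congr {f g : Baire} {s : ℕ} (h : ∀ i < s, f i = g i) : pre f s = pre g s :=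
  List.map_congr_left fun i hi => h i (List.mem_range.1 hi)

lemma take_pre {f : Baire} {s t : ℕ} (h : s ≤ t) : (pre f t).take s = pre f s := by
  rw [List.prefix_iff_eq_take.1 (pre_prefix (f := f) h)]; simp

/-- A family of partial functions of finite strings is monotone if values persist under
extensions of the string. -/
def Mono {α β : Type*} (ψ : List ℕ → α → Option β) : Prop :=
  ∀ ⦃σ τ : List ℕ⦄ ⦃a : α⦄ ⦃b : β⦄, σ <+: τ → ψ σ a = some b → ψ τ a = some b

lemma Mono.eq {α β : Type*} {ψ : List ℕ → α → Option β} (h : Mono ψ) {f : Baire} {s t : ℕ} {a : α}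
    {b c : β} (hs : ψ (pre f s) a = some b) (ht : ψ (pre f t) a = some c) : b = c := by
  have h1 := h (pre_prefix (le_max_left s t)) hs
  have h2 := h (pre_prefix (le_max_right s t)) ht
  exact Option.some.inj (h1.symm.trans h2)

/-- The function `G x : α → β` is computable from the oracle `o x`, uniformly in `x`. -/
def UComp {X α β : Type*} [Primcodable α] [Primcodable β] (o : X → Baire) (G : X → α → β) : Prop :=
  -- Primitive recursive approximations suffice, because the length of the string also bounds the
  -- searches.
  ∃ ψ : List ℕ → α → Option β, Primrec₂ ψ ∧ Mono ψ ∧ ∀ x a, ∃ s, ψ (pre (o x) s) a = some (G x a)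

/-- The predicate `P x` is decidable in the oracle `o x`, uniformly in `x`. -/
def UPred {X α : Type*} [Primcodable α] (o : X → Baire) (P : X → α → Prop) : Prop :=
  UComp o fun x a => @decide (P x a) (Classical.propDecidable _)

/-! ### Closure properties of uniform computability -/

section Closure

variable {X Y α β γ δ : Type*} [Primcodable α] [Primcodable β] [Primcodable γ] [Primcodable δ]
  {o : X → Baire}

lemma UComp.of_primrec {h : α → β} (hh : Primrec h) : UComp o fun _ a => h a :=
  ⟨fun _ a => some (h a), Primrec.option_some.comp (hh.comp Primrec.snd), fun _ _ _ _ _ h => h,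
    fun _ _ => ⟨0, rfl⟩⟩

lemma UComp.const (b : β) : UComp o fun (_ : X) (_ : α) => b := .of_primrec (Primrec.const b)

lemma UComp.oracle : UComp o o := by
  refine ⟨fun σ n => σ[n]?, Primrec.list_getElem?, fun σ τ a b h => ?_,
    fun x n => ⟨n + 1, getElem?_pre n.lt_succ_self⟩⟩
  obtain ⟨ρ, rfl⟩ := h
  intro hb
  obtain ⟨h', -⟩ := List.getElem?_eq_some_iff.1 hb
  simpa [List.getElem?_append_left h'] using hb

lemma UComp.congr {G H : X → α → β} (hG : UComp o G) (h : ∀ x a, G x a = H x a) : UComp o H := by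
  have : G = H := funext₂ h
  exact this ▸ hG

lemma UComp.restrict {G : X → α → β} (hG : UComp o G) (i : Y → X) :
    UComp (fun y => o (i y)) fun y => G (i y) := by
  obtain ⟨ψ, h1, h2, h3⟩ := hG
  exact ⟨ψ, h1, h2, fun y => h3 (i y)⟩

lemma UComp.comp {G : X → β → γ} {H : X → α → β} (hG : UComp o G) (hH : UComp o H) :
    UComp o fun x a => G x (H x a) := by
  obtain ⟨ψ, h1, h2, h3⟩ := hG
  obtain ⟨φ, k1, k2, k3⟩ := hH
  refine ⟨fun σ a => (φ σ a).bind fun b => ψ σ b,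
    Primrec.option_bind k1 (h1.comp (Primrec.fst.comp Primrec.fst) Primrec.snd),
    fun σ τ a b h hb => ?_, fun x a => ?_⟩
  · obtain ⟨c, hc, hb⟩ := Option.bind_eq_some_iff.1 hb
    exact Option.bind_eq_some_iff.2 ⟨c, k2 h hc, h2 h hb⟩
  · obtain ⟨s, hs⟩ := h3 x (H x a)
    obtain ⟨t, ht⟩ := k3 x a
    exact ⟨max s t, Option.bind_eq_some_iff.2 ⟨_, k2 (pre_prefix (le_max_right s t)) ht,
      h2 (pre_prefix (le_max_left s t)) hs⟩⟩

lemma UComp.map {G : X → α → β} {h : β → γ} (hh : Primrec h) (hG : UComp o G) :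
    UComp o fun x a => h (G x a) :=
  UComp.comp (G := fun _ b => h b) (.of_primrec hh) hG

lemma UComp.sub {G : X → β → γ} {h : α → β} (hG : UComp o G) (hh : Primrec h) :
    UComp o fun x a => G x (h a) :=
  hG.comp (.of_primrec hh)

lemma UComp.pair {G : X → α → β} {H : X → α → γ} (hG : UComp o G) (hH : UComp o H) :
    UComp o fun x a => (G x a, H x a) := by
  obtain ⟨ψ, h1, h2, h3⟩ := hG
  obtain ⟨φ, k1, k2, k3⟩ := hH
  refine ⟨fun σ a => (ψ σ a).bind fun b => (φ σ a).map fun c => (b, c),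
    Primrec.option_bind h1 (Primrec.option_map (k1.comp (Primrec.fst.comp Primrec.fst)
      (Primrec.snd.comp Primrec.fst)) (Primrec.pair (Primrec.snd.comp Primrec.fst) Primrec.snd)),
    fun σ τ a b h hb => ?_, fun x a => ?_⟩
  · obtain ⟨c, hc, hb⟩ := Option.bind_eq_some_iff.1 hb
    obtain ⟨d, hd, hb⟩ := Option.map_eq_some_iff.1 hb
    exact Option.bind_eq_some_iff.2 ⟨c, h2 h hc, Option.map_eq_some_iff.2 ⟨d, k2 h hd, hb⟩⟩
  · obtain ⟨s, hs⟩ := h3 x a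
    obtain ⟨t, ht⟩ := k3 x a
    exact ⟨max s t, Option.bind_eq_some_iff.2 ⟨_, h2 (pre_prefix (le_max_left s t)) hs,
      Option.map_eq_some_iff.2 ⟨_, k2 (pre_prefix (le_max_right s t)) ht, rfl⟩⟩⟩

lemma UComp.map₂ {G : X → α → β} {H : X → α → γ} {h : β → γ → δ} (hh : Primrec₂ h)
    (hG : UComp o G) (hH : UComp o H) : UComp o fun x a => h (G x a) (H x a) :=
  (hG.pair hH).map (h := fun p : β × γ => h p.1 p.2) hh

/-! ### Predicates -/

lemma UPred.of_primrec {P : α → Prop} (h : PrimrecPred P) : UPred o fun _ a => P a := by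
  classical
  exact (UComp.of_primrec h.decide).congr fun _ _ => by congr

lemma UPred.congr {P Q : X → α → Prop} (hP : UPred o P) (h : ∀ x a, P x a ↔ Q x a) : UPred o Q := by
  have : P = Q := funext₂ fun x a => propext (h x a)
  exact this ▸ hP

lemma UPred.sub {P : X → β → Prop} {h : α → β} (hP : UPred o P) (hh : Primrec h) :
    UPred o fun x a => P x (h a) := UComp.sub hP hh

lemma UPred.comp {P : X → β → Prop} {H : X → α → β} (hP : UPred o P) (hH : UComp o H) :
    UPred o fun x a => P x (H x a) := UComp.comp hP hH

lemma UPred.map₂ {G : X → α → β} {H : X → α → γ} {R : β → γ → Prop} (hR : PrimrecRel R)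
    (hG : UComp o G) (hH : UComp o H) : UPred o fun x a => R (G x a) (H x a) :=
  UPred.comp (P := fun _ (p : β × γ) => R p.1 p.2) (.of_primrec hR) (hG.pair hH)

lemma UPred.eq {G H : X → α → β} (hG : UComp o G) (hH : UComp o H) :
    UPred o fun x a => G x a = H x a := UPred.map₂ Primrec.eq hG hH

lemma UPred.lt {G H : X → α → ℕ} (hG : UComp o G) (hH : UComp o H) :
    UPred o fun x a => G x a < H x a := UPred.map₂ Primrec.nat_lt hG hH

lemma UPred.le {G H : X → α → ℕ} (hG : UComp o G) (hH : UComp o H) :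
    UPred o fun x a => G x a ≤ H x a := UPred.map₂ Primrec.nat_le hG hH

lemma UPred.of_bool {G : X → α → Bool} (hG : UComp o G) : UPred o fun x a => G x a = true :=
  UPred.eq hG (.const true)

lemma UPred.not {P : X → α → Prop} (hP : UPred o P) : UPred o fun x a => ¬ P x a :=
  (UComp.map Primrec.not hP).congr fun x a => by by_cases h : P x a <;> simp [h]

lemma UPred.and {P Q : X → α → Prop} (hP : UPred o P) (hQ : UPred o Q) :
    UPred o fun x a => P x a ∧ Q x a :=
  (UComp.map₂ Primrec.and hP hQ).congr fun x a => by
    by_cases h : P x a <;> by_cases h' : Q x a <;> simp [h, h']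

lemma UPred.or {P Q : X → α → Prop} (hP : UPred o P) (hQ : UPred o Q) :
    UPred o fun x a => P x a ∨ Q x a :=
  (UComp.map₂ Primrec.or hP hQ).congr fun x a => by
    by_cases h : P x a <;> by_cases h' : Q x a <;> simp [h, h']

lemma UPred.imp {P Q : X → α → Prop} (hP : UPred o P) (hQ : UPred o Q) :
    UPred o fun x a => P x a → Q x a :=
  (hP.not.or hQ).congr fun _ _ => by tauto

open Classical in
lemma UComp.ite {P : X → α → Prop} {G H : X → α → β} (hP : UPred o P) (hG : UComp o G)
    (hH : UComp o H) : UComp o fun x a => if P x a then G x a else H x a := by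
  have h : Primrec fun p : Bool × β × β => bif p.1 then p.2.1 else p.2.2 :=
    Primrec.cond Primrec.fst (Primrec.fst.comp Primrec.snd) (Primrec.snd.comp Primrec.snd)
  exact (UComp.map h (UComp.pair hP (hG.pair hH))).congr fun x a => by
    by_cases hp : P x a <;> simp [hp]

open Classical in
lemma UPred.of_iff_bool {P : X → α → Prop} {G : X → α → Bool} (hG : UComp o G)
    (h : ∀ x a, P x a ↔ G x a = true) : UPred o P :=
  (UPred.of_bool hG).congr fun x a => (h x a).symm

/-! ### Recursion and search -/

lemma UComp.nat_rec {G : X → α → β} {H : X → α × ℕ × β → β} (hG : UComp o G) (hH : UComp o H) :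
    UComp o fun x (p : α × ℕ) =>
      (Nat.rec (G x p.1) (fun k v => H x (p.1, k, v)) p.2 : β) := by
  obtain ⟨ψ, h1, h2, h3⟩ := hG
  obtain ⟨φ, k1, k2, k3⟩ := hH
  have key : Mono fun σ (p : α × ℕ) =>
      (Nat.rec (ψ σ p.1) (fun k v => v.bind fun w => φ σ (p.1, k, w)) p.2 : Option β) := by
    rintro σ τ ⟨a, n⟩ b h
    induction n generalizing b with
    | zero => exact h2 h
    | succ n ih =>
      intro hb
      obtain ⟨c, hc, hb⟩ := Option.bind_eq_some_iff.1 hb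
      exact Option.bind_eq_some_iff.2 ⟨c, ih hc, k2 h hb⟩
  refine ⟨_, ?_, key, fun x p => ?_⟩
  · refine (Primrec.nat_rec' (f := fun q : List ℕ × α × ℕ => q.2.2) (g := fun q => ψ q.1 q.2.1)
      (h := fun q (r : ℕ × Option β) => r.2.bind fun w => φ q.1 (q.2.1, r.1, w)) ?_ ?_ ?_)
    · exact Primrec.snd.comp Primrec.snd
    · exact h1.comp Primrec.fst (Primrec.fst.comp Primrec.snd)
    · refine Primrec.option_bind (Primrec.snd.comp Primrec.snd) (k1.comp
        (Primrec.fst.comp (Primrec.fst.comp Primrec.fst)) ?_)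
      exact Primrec.pair (Primrec.fst.comp (Primrec.snd.comp (Primrec.fst.comp Primrec.fst)))
        (Primrec.pair (Primrec.fst.comp (Primrec.snd.comp Primrec.fst)) Primrec.snd)
  · obtain ⟨a, n⟩ := p
    induction n with
    | zero => exact h3 x a
    | succ n ih =>
      obtain ⟨s, hs⟩ := ih
      obtain ⟨t, ht⟩ := k3 x (a, n, (Nat.rec (G x a) (fun k v => H x (a, k, v)) n : β))
      exact ⟨max s t, Option.bind_eq_some_iff.2 ⟨_, key (pre_prefix (le_max_left s t)) hs,
        k2 (pre_prefix (le_max_right s t)) ht⟩⟩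

lemma UPred.forall_lt {P : X → α × ℕ → Prop} (hP : UPred o P) :
    UPred o fun x (p : α × ℕ) => ∀ i < p.2, P x (p.1, i) := by
  classical
  have := UComp.nat_rec (o := o) (G := fun _ (_ : α) => true)
    (H := fun x (p : α × ℕ × Bool) => p.2.2 && decide (P x (p.1, p.2.1))) (.const true)
    (UComp.map₂ Primrec.and (.of_primrec (Primrec.snd.comp Primrec.snd))
      (UComp.congr (UPred.sub hP (h := fun p : α × ℕ × Bool => (p.1, p.2.1))
        (Primrec.pair Primrec.fst (Primrec.fst.comp Primrec.snd))) fun x a => by congr))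
  refine UPred.of_iff_bool this fun x ⟨a, n⟩ => ?_
  induction n with
  | zero => simp
  | succ n ih =>
    simp only [Bool.and_eq_true, decide_eq_true_eq] at ih ⊢
    rw [← ih]
    simp only [Nat.lt_succ_iff_lt_or_eq]
    exact ⟨fun h => ⟨fun i hi => h i (.inl hi), h n (.inr rfl)⟩,
      fun h i hi => hi.elim (h.1 i) fun e => e ▸ h.2⟩

lemma UComp.list {G : X → α × ℕ → β} (hG : UComp o G) :
    UComp o fun x (p : α × ℕ) => (List.range p.2).map fun i => G x (p.1, i) := by
  have := UComp.nat_rec (o := o) (G := fun _ (_ : α) => ([] : List β))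
    (H := fun x (p : α × ℕ × List β) => p.2.2 ++ [G x (p.1, p.2.1)]) (.const [])
    (UComp.map₂ (h := fun (l : List β) b => l ++ [b]) Primrec.list_concat (.of_primrec (Primrec.snd.comp Primrec.snd))
      (UComp.sub hG (h := fun p : α × ℕ × List β => (p.1, p.2.1))
        (Primrec.pair Primrec.fst (Primrec.fst.comp Primrec.snd))))
  refine this.congr fun x ⟨a, n⟩ => ?_
  induction n with
  | zero => rfl
  | succ n ih => simpa [List.range_succ] using ih

lemma findIdx_range_eq {p : ℕ → Bool} {n N : ℕ} (hn : p n = true) (hmin : ∀ m < n, p m = false)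
    (hN : n ≤ N) : (List.range N).findIdx p = n := by
  rcases hN.lt_or_eq with h | rfl
  · rw [List.findIdx_eq (by simpa using h)]
    simpa using ⟨hn, hmin⟩
  · have := (List.findIdx_eq_length (p := p) (xs := List.range n)).2
      (fun m hm => by simpa using hmin m (List.mem_range.1 hm))
    simpa using this

lemma findIdx_range_spec {p : ℕ → Bool} {N m : ℕ} (h : m < (List.range N).findIdx p) :
    p m = false := by
  have h' := List.not_of_lt_findIdx h
  simpa using h'

lemma findIdx_range_le (p : ℕ → Bool) (N : ℕ) : (List.range N).findIdx p ≤ N := by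
  simpa using List.findIdx_le_length (p := p) (xs := List.range N)

/-- Unbounded search for approximations: the least `n` such that `ψ σ (a, n)` is not known
to fail. -/
def searchApprox (ψ : List ℕ → α × ℕ → Option Bool) (σ : List ℕ) (a : α) : Option ℕ :=
  -- An undecided `n` blocks the search. A longer string can therefore never replace an answer by a
  -- smaller one, and the approximation is monotone.
  let n := (List.range σ.length).findIdx fun n => decide (ψ σ (a, n) ≠ some false)
  if ψ σ (a, n) = some true then some n else none

omit [Primcodable α] in
lemma searchApprox_eq_some {ψ : List ℕ → α × ℕ → Option Bool} {σ : List ℕ} {a : α} {n : ℕ} :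
    searchApprox ψ σ a = some n ↔ n ≤ σ.length ∧ ψ σ (a, n) = some true ∧
      ∀ m < n, ψ σ (a, m) = some false := by
  constructor
  · intro h
    simp only [searchApprox] at h
    split_ifs at h with h'
    obtain rfl := Option.some.inj h
    exact ⟨findIdx_range_le _ _, h', fun m hm => by simpa using findIdx_range_spec hm⟩
  · rintro ⟨h1, h2, h3⟩
    have := findIdx_range_eq (p := fun n => decide (ψ σ (a, n) ≠ some false)) (n := n)
      (by simp [h2]) (fun m hm => by simp [h3 m hm]) h1
    simp only [searchApprox, this, h2, if_true]

/-- Only finitely many tests, up to the least witness, have to be decided, so one sufficiently long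
initial segment settles all of them. -/
lemma UComp.find {P : X → α × ℕ → Prop} (hP : UPred o P) {G : X → α → ℕ}
    (h : ∀ x a, P x (a, G x a) ∧ ∀ m < G x a, ¬ P x (a, m)) : UComp o G := by
  classical
  obtain ⟨ψ, h1, h2, h3⟩ := hP
  have hdec : Primrec fun q : (List ℕ × α) × ℕ => decide (ψ q.1.1 (q.1.2, q.2) ≠ some false) := by
    refine PrimrecPred.decide (PrimrecPred.not (Primrec.eq.comp ?_ (Primrec.const _)))
    exact h1.comp (Primrec.fst.comp Primrec.fst)
      (Primrec.pair (Primrec.snd.comp Primrec.fst) Primrec.snd)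
  have hidx : Primrec fun q : List ℕ × α => (List.range q.1.length).findIdx fun n =>
      decide (ψ q.1 (q.2, n) ≠ some false) :=
    Primrec.list_findIdx (Primrec.list_range.comp (Primrec.list_length.comp Primrec.fst)) hdec
  refine ⟨searchApprox ψ, ?_, fun σ τ a n h hn => ?_, fun x a => ?_⟩
  · refine Primrec.ite (Primrec.eq.comp (h1.comp Primrec.fst (Primrec.pair Primrec.snd hidx))
      (Primrec.const _)) (Primrec.option_some.comp hidx) (Primrec.const none)
  · rw [searchApprox_eq_some] at hn ⊢
    exact ⟨hn.1.trans h.length_le, h2 h hn.2.1, fun m hm => h2 h (hn.2.2 m hm)⟩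
  · have key : ∀ N, ∃ s, N ≤ s ∧ ∀ m < N, ψ (pre (o x) s) (a, m) =
        some (@decide (P x (a, m)) (Classical.propDecidable _)) := by
      intro N
      induction N with
      | zero => exact ⟨0, le_rfl, by simp⟩
      | succ N ih =>
        obtain ⟨s, hs, ih⟩ := ih
        obtain ⟨t, ht⟩ := h3 x (a, N)
        refine ⟨max s t + 1, by omega, fun m hm => ?_⟩
        rcases Nat.lt_succ_iff_lt_or_eq.1 hm with hm | rfl
        · exact h2 (pre_prefix (by omega)) (ih m hm)
        · exact h2 (pre_prefix (by omega)) ht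
    obtain ⟨s, hs, hk⟩ := key (G x a + 1)
    refine ⟨s, searchApprox_eq_some.2 ⟨by simp; omega, ?_, fun m hm => ?_⟩⟩
    · simpa [(h x a).1] using hk _ (Nat.lt_succ_self _)
    · simpa [(h x a).2 m hm] using hk m (by omega)

/-- Any everywhere successful search can be carried out by a computable selector. -/
lemma UComp.exists_find {P : X → α × ℕ → Prop} (hP : UPred o P) (h : ∀ x a, ∃ n, P x (a, n)) :
    ∃ G : X → α → ℕ, UComp o G ∧ ∀ x a, P x (a, G x a) ∧ ∀ m < G x a, ¬ P x (a, m) := by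
  classical
  have h' : ∀ x a, P x (a, Nat.find (h x a)) ∧ ∀ m < Nat.find (h x a), ¬ P x (a, m) :=
    fun x a => ⟨Nat.find_spec (h x a), fun m hm => Nat.find_min (h x a) hm⟩
  exact ⟨fun x a => Nat.find (h x a), .find hP h', h'⟩

end Closure

/-! ### Transitivity -/

section Transitivity

variable {X Y α β γ δ : Type*} [Primcodable α] [Primcodable β] [Primcodable γ] [Primcodable δ]

/-- The initial segment of the oracle computed by `φ` from `σ` in at most `n` steps. -/
def chase (φ : List ℕ → ℕ → Option ℕ) (σ : List ℕ) : ℕ → List ℕ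
  | 0 => []
  | n + 1 => chase φ σ n ++ (φ σ (chase φ σ n).length).toList

lemma length_chase_le (φ : List ℕ → ℕ → Option ℕ) (σ : List ℕ) (n : ℕ) :
    (chase φ σ n).length ≤ n := by
  induction n with
  | zero => simp [chase]
  | succ n ih =>
    have : (φ σ (chase φ σ n).length).toList.length ≤ 1 := by
      cases φ σ (chase φ σ n).length <;> simp
    simp only [chase, List.length_append]
    omega

lemma chase_spec (φ : List ℕ → ℕ → Option ℕ) (σ : List ℕ) (n : ℕ) :
    ∀ i v, (chase φ σ n)[i]? = some v → φ σ i = some v := by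
  induction n with
  | zero => simp [chase]
  | succ n ih =>
    intro i v h
    simp only [chase, List.getElem?_append] at h
    split_ifs at h with h'
    · exact ih i v h
    · cases hc : φ σ (chase φ σ n).length with
      | none => simp [hc] at h
      | some w =>
        rw [hc] at h
        rcases Nat.eq_zero_or_pos (i - (chase φ σ n).length) with h0 | h0
        · have : i = (chase φ σ n).length := by omega
          subst this
          simpa [hc] using h
        · rw [List.getElem?_eq_none (by simp only [Option.toList_some, List.length_singleton]; exact h0)] at h
          cases h

/-- The chase halts only at the first value that `φ` does not yet supply, so it contains every
correct initial segment that its number of steps permits. This maximality makes it monotone in `σ`.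
-/
lemma prefix_chase {φ : List ℕ → ℕ → Option ℕ} {σ : List ℕ} {n : ℕ} {u : List ℕ}
    (h : ∀ i v, u[i]? = some v → φ σ i = some v) (hn : u.length ≤ n) : u <+: chase φ σ n := by
  induction n generalizing u with
  | zero => simp [List.length_eq_zero_iff.1 (Nat.le_zero.1 hn)]
  | succ n ih =>
    rcases hn.lt_or_eq with hn | hn
    · exact (ih h (by omega)).trans (List.prefix_append _ _)
    · obtain ⟨u, v, rfl⟩ := List.eq_nil_or_concat'  u |>.resolve_left (by rintro rfl; simp at hn)
      have hu : u.length = n := by simpa using hn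
      have hp : u <+: chase φ σ n := ih (fun i w hi => h i w (by
        obtain ⟨hlt, -⟩ := List.getElem?_eq_some_iff.1 hi
        rwa [List.getElem?_append_left hlt])) hu.le
      have he : u = chase φ σ n :=
        hp.eq_of_length_le (by rw [hu]; exact length_chase_le φ σ n)
      have hv : φ σ u.length = some v := h _ _ (by simp)
      simp [chase, ← he, hv]

lemma chase_mono {φ : List ℕ → ℕ → Option ℕ} (hφ : Mono φ) {σ τ : List ℕ} (h : σ <+: τ) :
    chase φ σ σ.length <+: chase φ τ τ.length :=
  prefix_chase (fun i v hi => hφ h (chase_spec φ σ _ i v hi))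
    ((length_chase_le φ σ _).trans h.length_le)

/-- Composition of functionals: run `ψ` on the part of the intermediate oracle computed so far.
Convergence of `ψ` is needed only at the arguments supplied by `K`, so the lemma also covers the
partial universal functional. -/
lemma UComp.of_approx {o : X → Baire} {g : X → γ × ℕ → ℕ} (hg : UComp o g)
    {ψ : List ℕ → β → Option δ} (hψ : Primrec₂ ψ) (hm : Mono ψ) {K : X → α → γ × β}
    (hK : UComp o K) {y : X → α → δ}
    (h : ∀ x a, ∃ s, ψ (pre (fun n => g x ((K x a).1, n)) s) (K x a).2 = some (y x a)) :
    UComp o y := by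
  obtain ⟨φ, h1, h2, h3⟩ := hg
  obtain ⟨κ, k1, k2, k3⟩ := hK
  have hmono : ∀ c, Mono fun σ n => φ σ (c, n) := fun c σ τ a b h => h2 h
  refine ⟨fun σ a => (κ σ a).bind fun p => ψ (chase (fun σ n => φ σ (p.1, n)) σ σ.length) p.2,
    ?_, fun σ τ a b h => ?_, fun x a => ?_⟩
  · refine Primrec.option_bind k1 (hψ.comp ?_ (Primrec.snd.comp Primrec.snd))
    have : Primrec fun q : (List ℕ × α) × γ × β => (Nat.rec ([] : List ℕ)
        (fun _ t => t ++ (φ q.1.1 (q.2.1, t.length)).toList) q.1.1.length : List ℕ) := by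
      refine Primrec.nat_rec' (h := fun (q : (List ℕ × α) × γ × β) (r : ℕ × List ℕ) =>
        r.2 ++ (φ q.1.1 (q.2.1, r.2.length)).toList) (Primrec.list_length.comp
          (Primrec.fst.comp Primrec.fst)) (Primrec.const []) (Primrec.list_append.comp
          (Primrec.snd.comp Primrec.snd) (Primrec.optionToList.comp (h1.comp ?_ ?_)))
      · exact Primrec.fst.comp (Primrec.fst.comp Primrec.fst)
      · exact Primrec.pair (Primrec.fst.comp (Primrec.snd.comp Primrec.fst))
          (Primrec.list_length.comp (Primrec.snd.comp Primrec.snd))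
    refine this.of_eq fun q => ?_
    generalize q.1.1.length = n
    induction n with
    | zero => rfl
    | succ n ih => simp only [chase, ih]
  · intro hb
    obtain ⟨p, hp, hb⟩ := Option.bind_eq_some_iff.1 hb
    exact Option.bind_eq_some_iff.2 ⟨p, k2 h hp, hm (chase_mono (hmono p.1) h) hb⟩
  · obtain ⟨s, hs⟩ := h x a
    obtain ⟨t, ht⟩ := k3 x a
    have key : ∀ N, ∃ S, N ≤ S ∧ ∀ i < N,
        φ (pre (o x) S) ((K x a).1, i) = some (g x ((K x a).1, i)) := by
      intro N
      induction N with
      | zero => exact ⟨0, le_rfl, by simp⟩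
      | succ N ih =>
        obtain ⟨S, hS, ih⟩ := ih
        obtain ⟨T, hT⟩ := h3 x ((K x a).1, N)
        refine ⟨max S T + 1, by omega, fun m hm => ?_⟩
        rcases Nat.lt_succ_iff_lt_or_eq.1 hm with hm | rfl
        · exact h2 (pre_prefix (by omega)) (ih m hm)
        · exact h2 (pre_prefix (by omega)) hT
    obtain ⟨S, hS, hk⟩ := key s
    refine ⟨max S t, Option.bind_eq_some_iff.2 ⟨_, k2 (pre_prefix (le_max_right S t)) ht, ?_⟩⟩
    refine hm (prefix_chase (fun i v hi => ?_) ?_) hs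
    · have hi' : i < s := by
        obtain ⟨hlt, -⟩ := List.getElem?_eq_some_iff.1 hi
        simpa using hlt
      rw [getElem?_pre hi'] at hi
      obtain rfl := Option.some.inj hi
      exact h2 (pre_prefix (le_max_left S t)) (hk i hi')
    · simp; omega

/-- Transitivity, with a parameter on which the intermediate oracle depends. -/
lemma UComp.trans_param {o : Y → Baire} {g : X → Baire} {G : X → α → β} (hG : UComp g G)
    {g' : Y → γ × ℕ → ℕ} (hg : UComp o g') (ξ : Y → γ → X)
    (h : ∀ y c n, g (ξ y c) n = g' y (c, n)) :
    UComp o fun y (p : γ × α) => G (ξ y p.1) p.2 := by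
  obtain ⟨ψ, h1, h2, h3⟩ := hG
  refine .of_approx hg h1 h2 (K := fun _ p => p) (.of_primrec Primrec.id) fun y p => ?_
  obtain ⟨s, hs⟩ := h3 (ξ y p.1) p.2
  exact ⟨s, by rwa [← funext fun n => h y p.1 n]⟩

lemma UComp.trans {o g : X → Baire} {G : X → α → β} (hg : UComp o g) (hG : UComp g G) :
    UComp o G := by
  have := (hG.trans_param (hg.sub (Primrec.snd (α := Unit))) (fun x _ => x) fun _ _ _ => rfl).sub
    (h := fun a : α => ((), a)) (Primrec.pair (Primrec.const ()) Primrec.id)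
  exact this

lemma UComp.prod {o : X → Baire} {g : X → Baire} {h : X → Baire} (hg : UComp o g)
    (hh : UComp o h) : UComp o fun x => join (g x) (h x) := by
  have h2 : Primrec fun n : ℕ => n / 2 := Primrec.nat_div.comp Primrec.id (Primrec.const 2)
  refine (UComp.ite (P := fun _ n => n % 2 = 0) (.of_primrec (Primrec.eq.comp
    (Primrec.nat_mod.comp Primrec.id (Primrec.const 2)) (Primrec.const 0)))
    (hg.sub h2) (hh.sub h2)).congr fun x n => by simp [join]

end Transitivity

/-! ### Decoding joins and numbers -/

@[simp] lemma join_even (f g : Baire) (n : ℕ) : join f g (2 * n) = f n := by simp [join]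

@[simp] lemma join_odd (f g : Baire) (n : ℕ) : join f g (2 * n + 1) = g n := by
  have h : (2 * n + 1) % 2 ≠ 0 := by omega
  have h' : (2 * n + 1) / 2 = n := by omega
  simp [join, h']

lemma join_inj {f g f' g' : Baire} (h : join f g = join f' g') : f = f' ∧ g = g' :=
  ⟨funext fun n => by simpa using congrFun h (2 * n),
    funext fun n => by simpa using congrFun h (2 * n + 1)⟩

lemma ofNum_inj {a b : ℕ} (h : ofNum a = ofNum b) : a = b := by simpa [ofNum] using congrFun h 0

@[simp] lemma ofNum_zero_apply (a : ℕ) : ofNum a 0 = a := rfl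

section Projections

variable {X α : Type*} [Primcodable α] {o f g : X → Baire}

lemma UComp.left (h : UComp o fun x => join (f x) (g x)) : UComp o f :=
  (h.sub Primrec.nat_double).congr fun x n => by simp

lemma UComp.right (h : UComp o fun x => join (f x) (g x)) : UComp o g :=
  (h.sub Primrec.nat_double_succ).congr fun x n => by simp

lemma UComp.join_left : UComp (fun x => join (f x) (g x)) f := UComp.oracle.left

lemma UComp.join_right : UComp (fun x => join (f x) (g x)) g := UComp.oracle.right

lemma UComp.apply {g : X → Baire} (hg : UComp o g) (n : ℕ) : UComp o fun x (_ : α) => g x n :=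
  hg.sub (Primrec.const n)

lemma UComp.ofNum {c : X → ℕ} (h : UComp o fun x (_ : Unit) => c x) :
    UComp o fun x => ofNum (c x) :=
  (UComp.ite (P := fun _ n => n = 0) (.of_primrec (Primrec.eq.comp Primrec.id (Primrec.const 0)))
    (h.sub (Primrec.const ())) (.const 0)).congr fun x n => by simp [Weihrauch.ofNum]

end Projections

/-! ### The universal functional -/

/-- The computation of `Φ_e(σ)(x)` with search parameter `t`. -/
def stepApprox (σ : List ℕ) (p : ℕ × ℕ) (t : ℕ) : Option ℕ :=
  Nat.Partrec.Code.evaln t.unpair.2 (Denumerable.ofNat Nat.Partrec.Code p.1)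
    (Nat.pair (Encodable.encode (σ.take t.unpair.1)) p.2)

/-- The value of `Φ_e(σ)(x)` on the finite string `σ`, where `p = (e, x)`. -/
def univApprox (σ : List ℕ) (p : ℕ × ℕ) : Option ℕ :=
  stepApprox σ p ((List.range σ.length).findIdx fun t => (stepApprox σ p t).isSome)

lemma univApprox_eq_some {σ : List ℕ} {p : ℕ × ℕ} {y : ℕ} :
    univApprox σ p = some y ↔
      ∃ t ≤ σ.length, stepApprox σ p t = some y ∧ ∀ m < t, stepApprox σ p m = none := by
  constructor
  · intro h
    exact ⟨_, findIdx_range_le _ _, h, fun m hm => by simpa using findIdx_range_spec hm⟩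
  · rintro ⟨t, h1, h2, h3⟩
    rw [univApprox, findIdx_range_eq (n := t) (by simp [h2]) (fun m hm => by simp [h3 m hm]) h1, h2]

/-- The search parameter codes the length of the string it reads, and this length is at most the
parameter. Lengthening a string that is already that long changes nothing. -/
lemma stepApprox_of_prefix {σ τ : List ℕ} (h : σ <+: τ) (p : ℕ × ℕ) {t : ℕ} (ht : t ≤ σ.length) :
    stepApprox σ p t = stepApprox τ p t := by
  obtain ⟨ρ, rfl⟩ := h
  rw [stepApprox, stepApprox, List.take_append_of_le_length ((Nat.unpair_left_le t).trans ht)]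

lemma mono_univApprox : Mono univApprox := by
  intro σ τ p y h hy
  rw [univApprox_eq_some] at hy ⊢
  obtain ⟨t, h1, h2, h3⟩ := hy
  exact ⟨t, h1.trans h.length_le, by rw [← stepApprox_of_prefix h p h1, h2],
    fun m hm => by rw [← stepApprox_of_prefix h p (hm.le.trans h1), h3 m hm]⟩

lemma primrec_univApprox : Primrec₂ univApprox := by
  have hs : Primrec fun q : (List ℕ × ℕ × ℕ) × ℕ => stepApprox q.1.1 q.1.2 q.2 := by
    refine Nat.Partrec.Code.primrec_evaln.comp (Primrec.pair (Primrec.pair ?_ ?_)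
      (Primrec₂.natPair.comp (Primrec.encode.comp (Primrec.list_take.comp ?_ ?_)) ?_))
    · exact Primrec.snd.comp (Primrec.unpair.comp Primrec.snd)
    · exact (Primrec.ofNat Nat.Partrec.Code).comp
        (Primrec.fst.comp (Primrec.snd.comp Primrec.fst))
    · exact Primrec.fst.comp (Primrec.unpair.comp Primrec.snd)
    · exact Primrec.fst.comp Primrec.fst
    · exact Primrec.snd.comp (Primrec.snd.comp Primrec.fst)
  refine hs.comp (Primrec.pair Primrec.id (Primrec.list_findIdx
    (Primrec.list_range.comp (Primrec.list_length.comp Primrec.fst))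
    (Primrec₂.mk (Primrec.option_isSome.comp hs))))

lemma mem_rfindOpt {φ : ℕ → Option ℕ} {y : ℕ} :
    y ∈ Nat.rfindOpt φ ↔ ∃ t, φ t = some y ∧ ∀ m < t, φ m = none := by
  rw [Nat.rfindOpt, Part.mem_bind_iff]
  constructor
  · rintro ⟨t, ht, hy⟩
    exact ⟨t, by simpa using hy, fun m hm => by simpa using (Nat.mem_rfind.1 ht).2 hm⟩
  · rintro ⟨t, h1, h2⟩
    refine ⟨t, Nat.mem_rfind.2 ⟨?_, fun {m} hm => ?_⟩, ?_⟩
    · simp only [h1, Option.isSome_some]; exact Part.mem_some _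
    · simp only [h2 m hm, Option.isSome_none]; exact Part.mem_some _
    · simp [h1]

lemma mem_functional {e : ℕ} {f : Baire} {x y : ℕ} :
    y ∈ functional e f x ↔ ∃ s, univApprox (pre f s) (e, x) = some y := by
  have key : ∀ {t s : ℕ}, t ≤ s → stepApprox (pre f s) (e, x) t =
      Nat.Partrec.Code.evaln t.unpair.2 (Denumerable.ofNat Nat.Partrec.Code e)
        (Nat.pair (initSeg f t.unpair.1) x) := by
    intro t s h
    rw [stepApprox, take_pre ((Nat.unpair_left_le t).trans h)]
    rfl
  simp only [functional, mem_rfindOpt, univApprox_eq_some, length_pre]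
  constructor
  · rintro ⟨t, h1, h2⟩
    exact ⟨t, t, le_rfl, by rw [key le_rfl, h1], fun m hm => by rw [key hm.le, h2 m hm]⟩
  · rintro ⟨s, t, hts, h1, h2⟩
    exact ⟨t, by rw [← key hts, h1], fun m hm => by rw [← key (hm.le.trans hts), h2 m hm]⟩

lemma functional_unique {e : ℕ} {f : Baire} {x y z : ℕ} (hy : y ∈ functional e f x)
    (hz : z ∈ functional e f x) : y = z := Part.mem_unique hy hz

lemma Computes.unique {e : ℕ} {f g h : Baire} (hg : Computes e f g) (hh : Computes e f h) :
    g = h := funext fun x => functional_unique (hg x) (hh x)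

/-- Every monotone primitive recursive approximation defines a Turing functional. -/
lemma exists_functional {ψ : List ℕ → ℕ → Option ℕ} (hψ : Primrec₂ ψ) (hm : Mono ψ) :
    ∃ e, ∀ f x y, y ∈ functional e f x ↔ ∃ s, ψ (pre f s) x = some y := by
  have hp : Nat.Partrec fun n => (ψ (Denumerable.ofNat (List ℕ) n.unpair.1) n.unpair.2 :
      Part ℕ) := by
    refine Partrec.nat_iff.1 (Computable.ofOption (Primrec.to_comp ?_))
    exact hψ.comp ((Primrec.ofNat (List ℕ)).comp (Primrec.fst.comp Primrec.unpair))
      (Primrec.snd.comp Primrec.unpair)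
  obtain ⟨c, hc⟩ := Nat.Partrec.Code.exists_code.1 hp
  have hev : ∀ f s x y, y ∈ c.eval (Nat.pair (initSeg f s) x) ↔ ψ (pre f s) x = some y := by
    intro f s x y
    have : initSeg f s = Encodable.encode (pre f s) := rfl
    rw [hc]
    simp [this]
  refine ⟨Encodable.encode c, fun f x y => ?_⟩
  have hsound : ∀ y, y ∈ functional (Encodable.encode c) f x → ∃ s, ψ (pre f s) x = some y := by
    intro y hy
    obtain ⟨t, ht⟩ := Nat.rfindOpt_spec hy
    rw [Denumerable.ofNat_encode] at ht
    exact ⟨_, (hev f _ x y).1 (Nat.Partrec.Code.evaln_sound ht)⟩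
  refine ⟨hsound y, fun ⟨s, hs⟩ => ?_⟩
  obtain ⟨k, hk⟩ := Nat.Partrec.Code.evaln_complete.1 ((hev f s x y).2 hs)
  have hd : (functional (Encodable.encode c) f x).Dom :=
    Nat.rfindOpt_dom.2 ⟨Nat.pair s k, y, by simpa using hk⟩
  obtain ⟨t, ht⟩ := hsound _ (Part.get_mem hd)
  rw [hm.eq hs ht]
  exact Part.get_mem hd

section Universal

variable {X α β : Type*} [Primcodable α] [Primcodable β] {o : X → Baire}

lemma UComp.functional {g : X → Baire} (hg : UComp o g) {e i y : X → α → ℕ} (he : UComp o e)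
    (hi : UComp o i) (h : ∀ x a, y x a ∈ functional (e x a) (g x) (i x a)) : UComp o y :=
  .of_approx (hg.sub (Primrec.snd (α := Unit))) primrec_univApprox mono_univApprox
    (K := fun x a => ((), e x a, i x a)) ((UComp.const ()).pair (he.pair hi))
    fun x a => mem_functional.1 (h x a)

lemma UComp.of_computes {f g : X → Baire} {e : X → ℕ} (hf : UComp o f)
    (he : UComp o fun x (_ : ℕ) => e x) (h : ∀ x, Computes (e x) (f x) (g x)) : UComp o g :=
  .functional hf he (i := fun _ n => n) (.of_primrec Primrec.id) h

lemma UComp.exists_index {g : X → Baire} (hg : UComp o g) : ∃ e, ∀ x, Computes e (o x) (g x) := by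
  obtain ⟨ψ, h1, h2, h3⟩ := hg
  obtain ⟨e, he⟩ := exists_functional h1 h2
  exact ⟨e, fun x n => (he _ _ _).2 (h3 x n)⟩

/-! ### The Turing jump -/

open Classical in
/-- The Turing jump: the halting problem for Turing functionals with oracle `f`. -/
noncomputable def turingJump (f : Baire) : Baire := fun z =>
  if ∃ s, (univApprox (pre f s) z.unpair).isSome then 1 else 0

/-- The search for a witness is a functional that converges exactly at the codes of arguments having
one, and the jump decides convergence. Its output is always `0`, so it does not matter which witness
is seen first. -/
lemma UPred.exists {P : X → α × ℕ → Prop} (hP : UPred o P) :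
    UPred (fun x => turingJump (o x)) fun x a => ∃ n, P x (a, n) := by
  obtain ⟨ψ, h1, h2, h3⟩ := hP
  let idx : List ℕ → α → ℕ := fun σ a =>
    (List.range σ.length).findIdx fun n => decide (ψ σ (a, n) = some true)
  have hidx : Primrec₂ idx := by
    refine Primrec.list_findIdx (Primrec.list_range.comp (Primrec.list_length.comp Primrec.fst))
      (PrimrecPred.decide (Primrec.eq.comp (h1.comp (Primrec.fst.comp Primrec.fst)
        (Primrec.pair (Primrec.snd.comp Primrec.fst) Primrec.snd)) (Primrec.const _)))
  let φ : List ℕ → ℕ → Option ℕ := fun σ m => (Encodable.decode (α := α) m).bind fun a =>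
    if idx σ a < σ.length then some 0 else none
  have hφ : Primrec₂ φ := by
    refine Primrec.option_bind (Primrec.decode.comp Primrec.snd) (Primrec.ite
      (Primrec.nat_lt.comp (hidx.comp (Primrec.fst.comp Primrec.fst) Primrec.snd)
        (Primrec.list_length.comp (Primrec.fst.comp Primrec.fst)))
      (Primrec.const _) (Primrec.const _))
  have hlt : ∀ σ a, idx σ a < σ.length ↔ ∃ n < σ.length, ψ σ (a, n) = some true := by
    intro σ a
    have := List.findIdx_lt_length (p := fun n => decide (ψ σ (a, n) = some true))
      (xs := List.range σ.length)
    simpa [idx] using this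
  have hspec : ∀ σ m y, φ σ m = some y ↔ y = 0 ∧
      ∃ a, Encodable.decode (α := α) m = some a ∧ ∃ n < σ.length, ψ σ (a, n) = some true := by
    intro σ m y
    simp only [φ, Option.bind_eq_some_iff, ← hlt]
    constructor
    · rintro ⟨a, ha, h⟩
      split_ifs at h with h'
      exact ⟨(Option.some.inj h).symm, a, ha, h'⟩
    · rintro ⟨rfl, a, ha, h⟩
      exact ⟨a, ha, if_pos h⟩
  obtain ⟨e, he⟩ := exists_functional hφ (fun σ τ m y h hy => by
    rw [hspec] at hy ⊢
    obtain ⟨h0, a, ha, n, hn, hy⟩ := hy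
    exact ⟨h0, a, ha, n, hn.trans_le h.length_le, h2 h hy⟩)
  have hq : UComp (fun x => turingJump (o x)) fun x (a : α) =>
      turingJump (o x) (Nat.pair e (Encodable.encode a)) :=
    UComp.oracle.sub (Primrec₂.natPair.comp (Primrec.const e) Primrec.encode)
  refine (UPred.eq hq (.const 1)).congr fun x a => ?_
  have : (∃ s, (univApprox (pre (o x) s) (e, Encodable.encode a)).isSome) ↔ ∃ n, P x (a, n) := by
    simp only [Option.isSome_iff_exists]
    constructor
    · rintro ⟨s, y, h⟩
      obtain ⟨t, ht⟩ := (he _ _ _).1 (mem_functional.2 ⟨s, h⟩)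
      obtain ⟨-, b, hb, n, -, hn⟩ := (hspec _ _ _).1 ht
      obtain rfl : a = b := by simpa using hb
      obtain ⟨u, hu⟩ := h3 x (a, n)
      exact ⟨n, by simpa using (h2.eq hn hu).symm⟩
    · rintro ⟨n, hn⟩
      obtain ⟨u, hu⟩ := h3 x (a, n)
      have h0 : (0 : ℕ) ∈ Weihrauch.functional e (o x) (Encodable.encode a) := by
        refine (he _ _ _).2 ⟨max u (n + 1), (hspec _ _ _).2 ⟨rfl, a, by simp, n, by simp, ?_⟩⟩
        simpa [hn] using h2 (pre_prefix (le_max_left u (n + 1))) hu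
      obtain ⟨s, hs⟩ := mem_functional.1 h0
      exact ⟨s, 0, hs⟩
  simp [turingJump, this]

lemma UPred.jump_forall {P : X → α × ℕ → Prop} (hP : UPred o P) :
    UPred (fun x => turingJump (o x)) fun x a => ∀ n, P x (a, n) :=
  (hP.not.exists.not).congr fun x a => by push Not; rfl

lemma UPred.jump {P : X → α → Prop} (hP : UPred o P) :
    UPred (fun x => turingJump (o x)) P :=
  ((hP.sub (Primrec.fst (β := ℕ))).exists).congr fun x a => by simp

/-- A value of the oracle is found by search over its decidable graph, each test being answered by
the jump. -/
lemma UComp.jump_self : UComp (fun x => turingJump (o x)) o := by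
  refine UComp.find (P := fun x (p : ℕ × ℕ) => o x p.1 = p.2) (UPred.jump (UPred.eq
    (UComp.oracle.sub Primrec.fst) (.of_primrec Primrec.snd))) fun x a => ⟨rfl, fun m hm => ?_⟩
  exact fun h : o x a = m => by omega

lemma UComp.jump {G : X → α → β} (hG : UComp o G) : UComp (fun x => turingJump (o x)) G :=
  UComp.jump_self.trans hG

lemma UPred.ite_one_zero {P : X → ℕ → Prop} (hP : UPred o P) {g : X → Baire}
    (h : ∀ x n, (P x n → g x n = 1) ∧ (¬ P x n → g x n = 0)) : UComp o g :=
  (UComp.ite hP (.const 1) (.const 0)).congr fun x n => by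
    by_cases hp : P x n
    · simp [hp, (h x n).1]
    · simp [hp, (h x n).2]

lemma UComp.univ {g : X → Baire} (hg : UComp o g) {s : X → α → ℕ} {p : X → α → ℕ × ℕ}
    (hs : UComp o s) (hp : UComp o p) :
    UComp o fun x a => univApprox (pre (g x) (s x a)) (p x a) := by
  have hl : UComp o fun x n => pre (g x) n :=
    ((hg.sub (Primrec.snd (α := Unit))).list).sub (h := fun n : ℕ => ((), n))
      (Primrec.pair (Primrec.const ()) Primrec.id)
  exact UComp.map₂ primrec_univApprox (hl.comp hs) hp

lemma turingJump_mono {g : X → Baire} (hg : UComp o g) :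
    UComp (fun x => turingJump (o x)) fun x => turingJump (g x) := by
  have h : UPred o fun x (p : ℕ × ℕ) => (univApprox (pre (g x) p.2) p.1.unpair).isSome = true :=
    .of_bool (UComp.map Primrec.option_isSome (.univ hg (.of_primrec Primrec.snd)
      (.of_primrec (Primrec.unpair.comp Primrec.fst))))
  exact h.exists.ite_one_zero fun x n => by
    constructor <;> intro h <;> simp only [turingJump]
    · exact if_pos h
    · exact if_neg h

lemma iterate_turingJump_mono {g : X → Baire} (hg : UComp o g) (n : ℕ) :
    UComp (fun x => turingJump^[n] (o x)) fun x => turingJump^[n] (g x) := by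
  induction n with
  | zero => exact hg
  | succ n ih =>
    simp only [Function.iterate_succ_apply']
    exact turingJump_mono ih

/-! ### Limits -/

/-- A function computable from a limit is the limit of computable approximations. -/
lemma UComp.exists_limit [Inhabited β] {a : X → ℕ × ℕ → ℕ} (ha : UComp o a) {g : X → Baire}
    {G : X → α → β} (hG : UComp g G) :
    ∃ A : X → α × ℕ → β, UComp o A ∧ ∀ x, (∀ n, ∀ᶠ s in Filter.atTop, a x (n, s) = g x n) →
      ∀ b, ∀ᶠ s in Filter.atTop, A x (b, s) = G x b := by
  obtain ⟨ψ, h1, h2, h3⟩ := hG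
  refine ⟨fun x p => (ψ (pre (fun n => a x (n, p.2)) p.2) p.1).getD default, ?_,
    fun x hx b => ?_⟩
  · have hl : UComp o fun x (p : α × ℕ) => pre (fun n => a x (n, p.2)) p.2 :=
      ((ha.sub (h := fun q : (α × ℕ) × ℕ => (q.2, q.1.2)) (Primrec.pair Primrec.snd
        (Primrec.snd.comp Primrec.fst))).list).sub (h := fun p : α × ℕ => (p, p.2))
        (Primrec.pair Primrec.id Primrec.snd)
    exact UComp.map Primrec.option_getD_default
      (UComp.map₂ h1 hl (.of_primrec Primrec.fst))
  · obtain ⟨s, hs⟩ := h3 x b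
    have hev : ∀ᶠ t in Filter.atTop, ∀ n ∈ Set.Iio s, a x (n, t) = g x n :=
      (Filter.eventually_all_finite (Set.finite_Iio s)).2 fun n _ => hx n
    filter_upwards [hev, Filter.eventually_ge_atTop s] with t ht hst
    have he : pre (fun n => a x (n, t)) s = pre (g x) s := pre_congr fun i hi => ht i hi
    have := h2 (pre_prefix (f := fun n => a x (n, t)) hst) (he ▸ hs)
    simp [this]

/-- The jump is the limit of a computable sequence. -/
lemma exists_limit_turingJump :
    ∃ a : X → ℕ × ℕ → ℕ, UComp o a ∧
      ∀ x n, ∀ᶠ s in Filter.atTop, a x (n, s) = turingJump (o x) n := by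
  classical
  have hP : UPred o fun x (p : ℕ × ℕ) => (univApprox (pre (o x) p.2) p.1.unpair).isSome = true :=
    .of_bool (UComp.map Primrec.option_isSome (.univ .oracle (.of_primrec Primrec.snd)
      (.of_primrec (Primrec.unpair.comp Primrec.fst))))
  refine ⟨_, UComp.ite hP (.const 1) (.const 0), fun x n => ?_⟩
  by_cases h : ∃ s, (univApprox (pre (o x) s) n.unpair).isSome
  · obtain ⟨s, hs⟩ := h
    filter_upwards [Filter.eventually_ge_atTop s] with t ht
    obtain ⟨y, hy⟩ := Option.isSome_iff_exists.1 hs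
    have h1 : (univApprox (pre (o x) t) n.unpair).isSome = true := by
      rw [mono_univApprox (pre_prefix ht) hy]; rfl
    have h2 : turingJump (o x) n = 1 := if_pos ⟨s, hs⟩
    simp [h1, h2]
  · have h2 : turingJump (o x) n = 0 := if_neg h
    push Not at h
    exact Filter.Eventually.of_forall fun t => by simp [h t, h2]

end Universal

/-! ### Weihrauch reductions -/

/-- Weihrauch reducibility in terms of uniformly computable functions. -/
lemma weihrauchLE_iff {Q P : Problem} : WeihrauchLE Q P ↔
    ∃ p : Q.dom → Baire, UComp (fun x : Q.dom => x.1) p ∧ (∀ x, p x ∈ P.dom) ∧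
      ∃ q : {y : Q.dom × Baire // y.2 ∈ P.sol (p y.1)} → Baire,
        UComp (fun y => join y.1.1.1 y.1.2) q ∧ ∀ y, q y ∈ Q.sol y.1.1.1 := by
  constructor
  · rintro ⟨Φ, Ψ, h⟩
    choose p hp hΦ hg using fun x : Q.dom => h x.1 x.2
    choose q hq hΨ using fun y : {y : Q.dom × Baire // y.2 ∈ P.sol (p y.1)} => hg y.1.1 y.1.2 y.2
    exact ⟨p, .of_computes .oracle (.const Φ) hΦ, hp, q, .of_computes .oracle (.const Ψ) hΨ, hq⟩
  · rintro ⟨p, hp, hd, q, hq, hs⟩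
    obtain ⟨Φ, hΦ⟩ := hp.exists_index
    obtain ⟨Ψ, hΨ⟩ := hq.exists_index
    exact ⟨Φ, Ψ, fun f hf => ⟨p ⟨f, hf⟩, hd _, hΦ ⟨f, hf⟩, fun g hg =>
      ⟨q ⟨(⟨f, hf⟩, g), hg⟩, hs ⟨(⟨f, hf⟩, g), hg⟩, hΨ ⟨(⟨f, hf⟩, g), hg⟩⟩⟩⟩

lemma WeihrauchLE.trans {Q P R : Problem} (h : WeihrauchLE Q P) (h' : WeihrauchLE P R) :
    WeihrauchLE Q R := by
  obtain ⟨p, hp, hd, q, hq, hs⟩ := weihrauchLE_iff.1 h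
  obtain ⟨p', hp', hd', q', hq', hs'⟩ := weihrauchLE_iff.1 h'
  refine weihrauchLE_iff.2 ⟨fun x => p' ⟨p x, hd x⟩, hp.trans (hp'.restrict fun x => ⟨p x, hd x⟩),
    fun x => hd' _, ?_⟩
  let Y := {y : Q.dom × Baire // y.2 ∈ R.sol (p' ⟨p y.1, hd y.1⟩)}
  let i : Y → {y : P.dom × Baire // y.2 ∈ R.sol (p' y.1)} :=
    fun y => ⟨(⟨p y.1.1, hd _⟩, y.1.2), y.2⟩
  let j : Y → {y : Q.dom × Baire // y.2 ∈ P.sol (p y.1)} :=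
    fun y => ⟨(y.1.1, q' (i y)), hs' (i y)⟩
  have hm : UComp (fun y : Y => join y.1.1.1 y.1.2) fun y => q' (i y) :=
    ((UComp.join_left.trans (hp.restrict fun y : Y => y.1.1)).prod UComp.join_right).trans
      (hq'.restrict i)
  exact ⟨fun y => q (j y), (UComp.join_left.prod hm).trans (hq.restrict j), fun y => hs (j y)⟩

/-- A problem is reducible to any problem with more instances and fewer solutions. -/
lemma WeihrauchLE.of_subset {Q P : Problem} (h : Q.dom ⊆ P.dom)
    (h' : ∀ f ∈ Q.dom, P.sol f ⊆ Q.sol f) : WeihrauchLE Q P :=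
  weihrauchLE_iff.2 ⟨fun x => x.1, .oracle, fun x => h x.2, fun y => y.1.2, .join_right,
    fun y => h' _ y.1.1.2 y.2⟩

/-- The given reduction is absorbed into the two indices of the new instance. The number computed at
the end is the same, so solutions are passed back unchanged. -/
lemma firstOrderPart_mono {Q P : Problem} (h : WeihrauchLE Q P) :
    WeihrauchLE Q.firstOrderPart P.firstOrderPart := by
  obtain ⟨p, hp, hd, q, hq, hs⟩ := weihrauchLE_iff.1 h
  choose f Φ Ψ hx r hr hΦ hΨ using fun x : Q.firstOrderPart.dom => x.2
  have h0 : UComp (fun x : Q.firstOrderPart.dom => x.1)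
      fun x => join (f x) (join (ofNum (Φ x)) (ofNum (Ψ x))) := UComp.oracle.congr fun x n => by
    conv_lhs => rw [hx x]
  have hr' : UComp (fun x : Q.firstOrderPart.dom => x.1) r :=
    .of_computes h0.left (h0.right.left.apply 0) hΦ
  have hp' : UComp (fun x : Q.firstOrderPart.dom => x.1) fun x => p ⟨r x, hr x⟩ :=
    hr'.trans (hp.restrict fun x => ⟨r x, hr x⟩)
  obtain ⟨Φ', hΦ'⟩ := hp'.exists_index
  let Y := {y : Q.firstOrderPart.dom × Baire // y.2 ∈ P.sol (p ⟨r y.1, hr y.1⟩)}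
  let o : Y → Baire := fun y => join y.1.1.1 y.1.2
  let m : Y → Baire := fun y => q ⟨(⟨r y.1.1, hr _⟩, y.1.2), y.2⟩
  have hl : ∀ {g : Q.firstOrderPart.dom → Baire}, UComp (fun x => x.1) g →
      UComp o fun y => g y.1.1 := fun hg => UComp.join_left.trans (hg.restrict fun y : Y => y.1.1)
  have hm : UComp o m := ((hl hr').prod UComp.join_right).trans
    (hq.restrict fun y : Y => ⟨(⟨r y.1.1, hr _⟩, y.1.2), y.2⟩)
  have hdom : ∀ y : Y, (functional (Ψ y.1.1) (join (f y.1.1) (m y)) 0).Dom :=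
    fun y => hΨ _ _ (hs ⟨(⟨r y.1.1, hr _⟩, y.1.2), y.2⟩)
  let v : Y → ℕ := fun y => (functional (Ψ y.1.1) (join (f y.1.1) (m y)) 0).get (hdom y)
  have hv : UComp o fun y (_ : ℕ) => v y :=
    .functional ((hl h0.left).prod hm) ((hl h0.right.right).apply 0) (.const 0)
      fun y _ => Part.get_mem (hdom y)
  obtain ⟨Ψ', hΨ'⟩ := hv.exists_index
  refine weihrauchLE_iff.2 ⟨fun x => join x.1 (join (ofNum Φ') (ofNum Ψ')),
    UComp.oracle.prod ((UComp.const _).ofNum.prod (UComp.const _).ofNum), fun x => ?_,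
    fun y => y.1.2, .join_right, ?_⟩
  · exact ⟨x.1, Φ', Ψ', rfl, p ⟨r x, hr x⟩, hd _, hΦ' x,
      fun g hg => Part.dom_iff_mem.2 ⟨_, hΨ' ⟨(x, g), hg⟩ 0⟩⟩
  · rintro ⟨⟨x, z⟩, f₁, Φ₁, Ψ₁, he, p₁, hp₁, hc₁, g, hg, y, hy, hz⟩
    obtain rfl : z = ofNum y := hz
    obtain ⟨rfl, he'⟩ := join_inj he
    obtain ⟨e1, e2⟩ := join_inj he'
    obtain rfl := ofNum_inj e1
    obtain rfl := ofNum_inj e2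
    obtain rfl := hc₁.unique (hΦ' x)
    obtain rfl := functional_unique hy (hΨ' ⟨(x, g), hg⟩ 0)
    exact ⟨f x, Φ x, Ψ x, hx x, r x, hr x, hΦ x, m ⟨(x, g), hg⟩, hs ⟨(⟨r x, hr x⟩, g), hg⟩, _,
      Part.get_mem (hdom ⟨(x, g), hg⟩), rfl⟩

/-- A reduction computable in the `n`-th jump of the instance yields a reduction to the
`n`-th jump of the problem. -/
lemma exists_iterJump (P : Problem) (n : ℕ) : ∀ {X : Type} {o G : X → Baire},
    UComp (fun x => turingJump^[n] (o x)) G → (∀ x, G x ∈ P.dom) →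
    ∃ p : X → Baire, UComp o p ∧
      ∀ x, p x ∈ (P.iterJump n).dom ∧ (P.iterJump n).sol (p x) ⊆ P.sol (G x) := by
  induction n with
  | zero => exact fun {X o G} hG hd => ⟨G, hG, fun x => ⟨hd x, le_rfl⟩⟩
  | succ n ih =>
    intro X o G hG hd
    -- The jump next to `o` is peeled off first: the hypothesis is applied to the oracle `turingJump
    -- (o x)`, and the limit lemma then replaces the resulting instance by a `Δ^0_2` index relative
    -- to `o x`.
    obtain ⟨p, hp, hpd⟩ := ih (o := fun x => turingJump (o x)) hG hd
    obtain ⟨a, ha, hlim⟩ := exists_limit_turingJump (o := o)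
    obtain ⟨A, hA, hA'⟩ := UComp.exists_limit ha hp
    have hA₁ : UComp o fun x (n : ℕ) => A x n.unpair := hA.sub Primrec.unpair
    obtain ⟨i, hi⟩ := hA₁.exists_index
    have hidx : ∀ x, Problem.IsDelta2Index (o x) i (p x) := fun x =>
      ⟨_, hi x, fun n => by simpa using hA' x (hlim x) n⟩
    refine ⟨fun x => join (o x) (ofNum i), UComp.oracle.prod (UComp.const i).ofNum, fun x =>
      ⟨⟨o x, i, rfl, p x, (hpd x).1, hidx x⟩, ?_⟩⟩
    rintro y ⟨f, j, he, g, hg, ⟨b, hb, hlb⟩, hy⟩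
    obtain ⟨rfl, he'⟩ := join_inj he
    obtain rfl := ofNum_inj he'
    obtain rfl := hb.unique (hi x)
    have : g = p x := by
      funext n
      obtain ⟨s, h1, h2⟩ := ((hlb n).and (hA' x (hlim x) n)).exists
      rw [← h1, ← h2]
      simp
    subst this
    exact (hpd x).2 hy

/-! ### Comparisons among the Ramsey problems -/

lemma sRTNat_le (n : ℕ) : WeihrauchLE (SRTNat n) (RTNat n) :=
  .of_subset (fun _ ⟨k, hk, h⟩ => ⟨k, hk, h.1⟩)
    fun _ ⟨k, hk, h⟩ _ ⟨_, _, _, hg⟩ => ⟨k, hk, h, hg⟩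

lemma sRTPlus_le (n : ℕ) : WeihrauchLE (SRTPlus n) (RTPlus n) := by
  refine .of_subset (fun _ ⟨k, hk, f, h, e⟩ => ⟨k, hk, f, h.1, e⟩) ?_
  rintro _ ⟨k, hk, f, h, rfl⟩ _ ⟨k', -, f', -, he, g, hg, rfl⟩
  obtain ⟨e1, rfl⟩ := join_inj he
  obtain rfl := ofNum_inj e1
  exact ⟨k, hk, f, h, rfl, g, hg, rfl⟩

/-- If the problems `P k` have the same solutions to common instances, then their coproduct is
reducible to their union. -/
lemma joinFrom_le_unionFrom {m m' : ℕ} (hm : m' ≤ m) {P : ℕ → Problem} {S : Baire → Set Baire}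
    (h : ∀ k, (P k).sol = S) :
    WeihrauchLE (Problem.joinFrom m P) (Problem.unionFrom m' P) := by
  choose k hk f hf he using fun x : (Problem.joinFrom m P).dom => x.2
  have h0 : UComp (fun x : (Problem.joinFrom m P).dom => x.1) fun x => join (ofNum (k x)) (f x) :=
    UComp.oracle.congr fun x n => by conv_lhs => rw [he x]
  refine weihrauchLE_iff.2 ⟨f, h0.right, fun x => ⟨k x, hm.trans (hk x), hf x⟩,
    fun y => join (ofNum (k y.1.1)) y.1.2,
    (UComp.join_left.trans (h0.left.restrict fun y : {y : (Problem.joinFrom m P).dom × Baire //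
      y.2 ∈ (Problem.unionFrom m' P).sol (f y.1)} => y.1.1)).prod .join_right, fun y => ?_⟩
  obtain ⟨k', -, -, hg⟩ := y.2
  exact ⟨k y.1.1, hk _, f y.1.1, hf _, he _, y.1.2, by rwa [h, ← h k'], rfl⟩

lemma sRTPlus_le_sRTNat (n : ℕ) : WeihrauchLE (SRTPlus n) (SRTNat n) :=
  joinFrom_le_unionFrom (by norm_num) (S := (SRT n 1).sol) fun _ => rfl

lemma rTPlus_le_rTNat (n : ℕ) : WeihrauchLE (RTPlus n) (RTNat n) :=
  joinFrom_le_unionFrom (by norm_num) (S := (RT n 1).sol) fun _ => rfl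


/-! ### Trees of prehomogeneous sets -/

section Tree

variable (B : ℕ → Prop) (R : ℕ → ℕ → ℕ) (M : ℕ → ℕ)

open Classical in
/-- The number of functions `R m` on which the elements of the branch below `y` from `t` on are
required to agree with `y`. -/
noncomputable def width (y : ℕ) : ℕ → ℕ
  | 0 => 0
  | t + 1 => if B t ∧ ∀ m < width y t, R m t = R m y then max (width y t) (M t) else width y t

/-- `t` lies on the branch with top element `y`. -/
def Chain (y t : ℕ) : Prop := t ≤ y ∧ B t ∧ ∀ m < width B R M y t, R m t = R m y

variable {B R M}

lemma width_mono (y : ℕ) : Monotone (width B R M y) := by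
  refine monotone_nat_of_le_succ fun t => ?_
  simp only [width]
  split_ifs
  · exact le_max_left _ _
  · exact le_rfl

lemma Chain.le_width {y a t : ℕ} (h : Chain B R M y a) (hat : a < t) : M a ≤ width B R M y t := by
  refine le_trans ?_ (width_mono y (Nat.succ_le_of_lt hat))
  simp only [width, if_pos h.2]
  exact le_max_right _ _

/-- The bound is uniform in the top element. A branch without elements from `N` on is thus
constrained by boundedly many functions, however long it is. -/
lemma exists_width_le (N : ℕ) : ∃ W, ∀ y, width B R M y N ≤ W := by
  induction N with
  | zero => exact ⟨0, fun y => le_rfl⟩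
  | succ N ih =>
    obtain ⟨W, hW⟩ := ih
    refine ⟨max W (M N), fun y => ?_⟩
    simp only [width]
    split_ifs
    · exact max_le_max (hW y) le_rfl
    · exact (hW y).trans (le_max_left _ _)

lemma Chain.hom {y a z : ℕ} (ha : Chain B R M y a) (hz : Chain B R M y z) (h : a < z) :
    ∀ m < M a, R m z = R m y := fun m hm => hz.2.2 m (hm.trans_le (ha.le_width h))

lemma Chain.agree {y t t' : ℕ} (h : Chain B R M y t) (ht : t' < t)
    (hw : width B R M t t' = width B R M y t') :
    (∀ m < width B R M t t', R m t' = R m t) ↔ ∀ m < width B R M y t', R m t' = R m y := by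
  rw [hw]
  refine forall₂_congr fun m hm => ?_
  rw [h.2.2 m (hm.trans_le (width_mono y ht.le))]

lemma Chain.width_eq {y t : ℕ} (h : Chain B R M y t) :
    ∀ {t'}, t' ≤ t → width B R M t t' = width B R M y t'
  | 0, _ => rfl
  | t' + 1, ht => by
    have hw := h.width_eq (t' := t') (by omega)
    classical
    simp only [width]
    exact if_congr (and_congr_right fun _ => h.agree ht hw) (by rw [hw]) hw

/-- Coherence of the tree: the tests below `t` consult only those functions on which `t` and `y`
agree, so both tops reconstruct the same branch. -/
lemma Chain.iff {y t t' : ℕ} (h : Chain B R M y t) (ht : t' ≤ t) :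
    Chain B R M t t' ↔ Chain B R M y t' := by
  rcases ht.lt_or_eq with hlt | rfl
  · simp only [Chain, h.agree hlt (h.width_eq ht), ht, ht.trans h.1]
  · exact ⟨fun _ => h, fun _ => ⟨le_rfl, h.2.1, fun _ _ => rfl⟩⟩

/-- Pigeonhole: `W` functions with `k` values have finitely many patterns, and one representative is
fixed for each pattern that occurs from `N` on. -/
lemma exists_pattern_bound {k : ℕ} (hR : ∀ m y, R m y < k) (N W : ℕ) :
    ∃ Y, ∀ y, N ≤ y → B y → ∃ t, N ≤ t ∧ t ≤ Y ∧ B t ∧ ∀ m < W, R m t = R m y := by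
  let g : ℕ → Fin W → Fin k := fun y m => ⟨R m y, hR m y⟩
  have : ∀ q, ∃ Y, ∀ y, N ≤ y → B y → g y = q → ∃ t, N ≤ t ∧ t ≤ Y ∧ B t ∧ g t = q := by
    intro q
    by_cases h : ∃ t, N ≤ t ∧ B t ∧ g t = q
    · obtain ⟨t, h1, h2, h3⟩ := h
      exact ⟨t, fun y _ _ _ => ⟨t, h1, le_rfl, h2, h3⟩⟩
    · exact ⟨0, fun y h1 h2 h3 => (h ⟨y, h1, h2, h3⟩).elim⟩
  choose Y hY using this
  refine ⟨Finset.univ.sup Y, fun y h1 h2 => ?_⟩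
  obtain ⟨t, k1, k2, k3, k4⟩ := hY _ y h1 h2 rfl
  refine ⟨t, k1, k2.trans (Finset.le_sup (Finset.mem_univ _)), k3, fun m hm => ?_⟩
  have := congrFun k4 ⟨m, hm⟩
  simpa [g] using this

/-! ### Greedy cluster points -/

/-- `G` is the greedy cluster point of the sequence `y ↦ (S e y)_e` along `B`. -/
def IsGreedy (B : ℕ → Prop) (S : ℕ → ℕ → Prop) (G : ℕ → Prop) : Prop :=
  ∀ e, G e ↔ ∀ N, ∃ y, N ≤ y ∧ B y ∧ (∀ i < e, G i → S i y) ∧ S e y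

variable {S : ℕ → ℕ → Prop} {G : ℕ → Prop}

lemma IsGreedy.exists_good (hG : IsGreedy B S G) (hB : ∀ N, ∃ y, N ≤ y ∧ B y) (e N : ℕ) :
    ∃ y, N ≤ y ∧ B y ∧ ∀ i < e, G i → S i y := by
  induction e generalizing N with
  | zero => simpa using hB N
  | succ e ih =>
    by_cases h : G e
    · obtain ⟨y, h1, h2, h3, h4⟩ := (hG e).1 h N
      refine ⟨y, h1, h2, fun i hi _ => ?_⟩
      rcases Nat.lt_succ_iff_lt_or_eq.1 hi with hi | rfl
      · exact h3 i hi ‹_›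
      · exact h4
    · obtain ⟨y, h1, h2, h3⟩ := ih N
      refine ⟨y, h1, h2, fun i hi hi' => ?_⟩
      rcases Nat.lt_succ_iff_lt_or_eq.1 hi with hi | rfl
      · exact h3 i hi hi'
      · exact (h hi').elim

lemma IsGreedy.eventually_not (hG : IsGreedy B S G) {e : ℕ} (he : ¬ G e) :
    ∃ N, ∀ y, N ≤ y → B y → (∀ i < e, G i → S i y) → ¬ S e y := by
  rw [hG e] at he
  push Not at he
  exact he

/-- A rejected condition fails for all large `y` in `B` that satisfy the earlier accepted ones.
Beyond finitely many such thresholds, every `y` that satisfies the accepted conditions also violates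
the rejected ones. -/
lemma IsGreedy.exists_match (hG : IsGreedy B S G) (hB : ∀ N, ∃ y, N ≤ y ∧ B y) (e N : ℕ) :
    ∃ y, N ≤ y ∧ B y ∧ ∀ i < e, S i y ↔ G i := by
  have : ∃ N', ∀ y, N' ≤ y → B y → (∀ i < e, G i → S i y) → ∀ i < e, S i y → G i := by
    clear N
    induction e with
    | zero => simp
    | succ e ih =>
      obtain ⟨N, hN⟩ := ih
      by_cases h : G e
      · refine ⟨N, fun y h1 h2 h3 i hi hS => ?_⟩
        rcases Nat.lt_succ_iff_lt_or_eq.1 hi with hi | rfl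
        · exact hN y h1 h2 (fun i hi => h3 i (by omega)) i hi hS
        · exact h
      · obtain ⟨N', hN'⟩ := hG.eventually_not h
        refine ⟨max N N', fun y h1 h2 h3 i hi hS => ?_⟩
        rcases Nat.lt_succ_iff_lt_or_eq.1 hi with hi | rfl
        · exact hN y (by omega) h2 (fun i hi => h3 i (by omega)) i hi hS
        · exact (hN' y (by omega) h2 (fun j hj => h3 j (by omega)) hS).elim
  obtain ⟨N', hN'⟩ := this
  obtain ⟨y, h1, h2, h3⟩ := hG.exists_good hB e (max N N')
  exact ⟨y, by omega, h2, fun i hi => ⟨hN' y (by omega) h2 h3 i hi, h3 i hi⟩⟩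

/-! ### The limit branch -/

/-- The data for the limit of branches: properties `S e` of branches that are inherited by
subbranches and include the non-membership of any given number. -/
structure LimitBranch (B : ℕ → Prop) (R : ℕ → ℕ → ℕ) (M : ℕ → ℕ) (S : ℕ → ℕ → Prop)
    (G : ℕ → Prop) : Prop where
  infinite : ∀ N, ∃ y, N ≤ y ∧ B y
  bounded : ∃ k, ∀ m y, R m y < k
  antitone : ∀ {y t}, Chain B R M y t → ∀ e, S e y → S e t
  mem : ∀ z y, S (2 * z) y ↔ ¬ Chain B R M y z
  greedy : IsGreedy B S G

namespace LimitBranch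

/-- Every finite part of the limit is realized by an actual branch that also obeys finitely many
prescribed decisions. Properties of branches pass to the limit through this. -/
lemma exists_agree (h : LimitBranch B R M S G) (e N : ℕ) :
    ∃ y, N ≤ y ∧ B y ∧ (∀ z < N, ¬ G (2 * z) ↔ Chain B R M y z) ∧ ∀ i < e, S i y ↔ G i := by
  obtain ⟨y, h1, h2, h3⟩ := h.greedy.exists_match h.infinite (max e (2 * N)) N
  refine ⟨y, h1, h2, fun z hz => ?_, fun i hi => h3 i (by omega)⟩
  rw [← h3 (2 * z) (by omega), h.mem, not_not]

lemma chain_iff (h : LimitBranch B R M S G) {z t : ℕ} (hz : ¬ G (2 * z)) (ht : t ≤ z) :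
    ¬ G (2 * t) ↔ Chain B R M z t := by
  obtain ⟨y, -, -, h3, -⟩ := h.exists_agree 0 (z + 1)
  rw [h3 t (by omega), ((h3 z (by omega)).1 hz).iff ht]

lemma base (h : LimitBranch B R M S G) {z : ℕ} (hz : ¬ G (2 * z)) : B z :=
  ((h.chain_iff hz le_rfl).1 hz).2.1

lemma hom (h : LimitBranch B R M S G) {a z y : ℕ} (ha : ¬ G (2 * a)) (hz : ¬ G (2 * z))
    (hy : ¬ G (2 * y)) (haz : a < z) (hzy : z ≤ y) : ∀ m < M a, R m z = R m y :=
  ((h.chain_iff hy (haz.le.trans hzy)).1 ha).hom ((h.chain_iff hy hzy).1 hz) haz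

lemma of_greedy (h : LimitBranch B R M S G) {z e : ℕ} (hz : ¬ G (2 * z)) (he : G e) : S e z := by
  obtain ⟨y, -, -, h3, h4⟩ := h.exists_agree (e + 1) (z + 1)
  exact h.antitone ((h3 z (by omega)).1 hz) e ((h4 e (by omega)).2 he)

lemma eventually_not (h : LimitBranch B R M S G) {e : ℕ} (he : ¬ G e) :
    ∃ N, ∀ z, N ≤ z → ¬ G (2 * z) → ¬ S e z := by
  obtain ⟨N, hN⟩ := h.greedy.eventually_not he
  exact ⟨N, fun z h1 h2 => hN z h1 (h.base h2) fun i _ hi => h.of_greedy h2 hi⟩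

/-- If the limit stopped at `N`, a branch agreeing with it far enough would have no element in `[N,
Y]`, hence constant width there. The pattern bound provides a `t` in that interval with the pattern
of the top, and this `t` would lie on the branch. -/
lemma unbounded (h : LimitBranch B R M S G) (N : ℕ) : ∃ z, N ≤ z ∧ ¬ G (2 * z) := by
  by_contra hcon
  push Not at hcon
  obtain ⟨k, hk⟩ := h.bounded
  obtain ⟨W, hW⟩ := exists_width_le (B := B) (R := R) (M := M) N
  obtain ⟨Y, hY⟩ := exists_pattern_bound (B := B) hk N W
  obtain ⟨y, h1, h2, h3, -⟩ := h.exists_agree 0 (max N (Y + 1))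
  obtain ⟨t, k1, k2, k3, k4⟩ := hY y (by omega) h2
  have hno : ∀ u, N ≤ u → u ≤ Y → ¬ Chain B R M y u := fun u hu hu' hc =>
    (h3 u (by omega)).2 hc (hcon u hu)
  have hw : ∀ u, N ≤ u → u ≤ t → width B R M y u = width B R M y N := by
    intro u hu
    induction u, hu using Nat.le_induction with
    | base => exact fun _ => rfl
    | succ u hu ih =>
      intro hut
      simp only [width]
      rw [if_neg fun hc => hno u hu (by omega) ⟨by omega, hc⟩, ih (by omega)]
  exact hno t k1 k2 ⟨by omega, k3, fun m hm => k4 m (hm.trans_le (hw t k1 le_rfl ▸ hW y))⟩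

end LimitBranch

end Tree

/-! ### Computing the limit branch -/

section Compute

variable {X : Type*} {o : X → Baire}

/-- Once the earlier decisions are listed, the next one is a single `∀∃` question, decidable in the
double jump. Recursion on the list makes all decisions uniformly. -/
lemma exists_isGreedy {B : X → ℕ → Prop} {S : X → ℕ × ℕ → Prop} (hB : UPred o B)
    (hS : UPred o S) : ∃ G : X → ℕ → Prop,
      UPred (fun x => turingJump (turingJump (o x))) G ∧
      ∀ x, IsGreedy (B x) (fun e y => S x (e, y)) (G x) := by
  classical
  -- `Q` asks whether infinitely many `y` in `B` satisfy all conditions marked `true` in the list.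
  let Q : X → List Bool → Prop := fun x L => ∀ N, ∃ y, N ≤ y ∧ B x y ∧
    ∀ i < L.length, L.getD i false = true → S x (i, y)
  have hQ : UPred (fun x => turingJump (turingJump (o x))) Q := by
    have hq : UPred o fun x (p : (List Bool × ℕ) × ℕ) => p.1.2 ≤ p.2 ∧ B x p.2 ∧
        ∀ i < p.1.1.length, p.1.1.getD i false = true → S x (i, p.2) := by
      refine (UPred.le (.of_primrec (Primrec.snd.comp Primrec.fst))
        (.of_primrec Primrec.snd)).and ((hB.sub Primrec.snd).and ?_)
      refine UPred.sub (P := fun x (q : (List Bool × ℕ) × ℕ) => ∀ i < q.2,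
        q.1.1.getD i false = true → S x (i, q.1.2)) (UPred.forall_lt
          (P := fun x (q : (List Bool × ℕ) × ℕ) => q.1.1.getD q.2 false = true → S x (q.2, q.1.2))
          ((UPred.of_bool (.of_primrec ((Primrec.list_getD false).comp
            (Primrec.fst.comp Primrec.fst) Primrec.snd))).imp (hS.sub (Primrec.pair Primrec.snd
            (Primrec.snd.comp Primrec.fst)))))
        (h := fun p : (List Bool × ℕ) × ℕ => ((p.1.1, p.2), p.1.1.length)) ?_
      exact Primrec.pair (Primrec.pair (Primrec.fst.comp Primrec.fst) Primrec.snd)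
        (Primrec.list_length.comp (Primrec.fst.comp Primrec.fst))
    exact hq.exists.jump_forall
  let L : X → ℕ → List Bool := fun x n =>
    Nat.rec [] (fun _ L => L ++ [@decide (Q x (L ++ [true])) (Classical.propDecidable _)]) n
  have hcat : ∀ b : Bool, Primrec fun l : List Bool => l ++ [b] := fun b =>
    Primrec.list_concat.comp Primrec.id (Primrec.const b)
  have hL : UComp (fun x => turingJump (turingJump (o x))) L := by
    have := UComp.nat_rec (o := fun x => turingJump (turingJump (o x)))
      (G := fun _ (_ : Unit) => ([] : List Bool)) (H := fun x (p : Unit × ℕ × List Bool) =>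
        p.2.2 ++ [@decide (Q x (p.2.2 ++ [true])) (Classical.propDecidable _)]) (.const [])
      (UComp.map₂ (h := fun (l : List Bool) b => l ++ [b]) Primrec.list_concat
        (.of_primrec (Primrec.snd.comp Primrec.snd))
        (UComp.sub (G := fun x l => @decide (Q x l) (Classical.propDecidable _)) hQ
          (h := fun p : Unit × ℕ × List Bool => p.2.2 ++ [true])
          ((hcat true).comp (Primrec.snd.comp Primrec.snd))))
    exact this.sub (h := fun n : ℕ => ((), n)) (Primrec.pair (Primrec.const ()) Primrec.id)
  let G : X → ℕ → Prop := fun x e => Q x (L x e ++ [true])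
  have hlen : ∀ x e, (L x e).length = e := by
    intro x e
    induction e with
    | zero => rfl
    | succ e ih => simpa [L] using ih
  have hget : ∀ x e i, i < e → ((L x e).getD i false = true ↔ G x i) := by
    intro x e
    induction e with
    | zero => simp
    | succ e ih =>
      intro i hi
      have hs : L x (e + 1) = L x e ++ [@decide (G x e) (Classical.propDecidable _)] := rfl
      rw [hs]
      rcases Nat.lt_succ_iff_lt_or_eq.1 hi with hi | rfl
      · rw [List.getD_append _ _ _ _ (by rwa [hlen]), ih i hi]
      · rw [List.getD_append_right _ _ _ _ (by rw [hlen])]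
        simp [hlen]
  refine ⟨G, hQ.comp (UComp.map (hcat true) hL), fun x e => ?_⟩
  refine forall_congr' fun N => exists_congr fun y => and_congr_right fun _ =>
    and_congr_right fun _ => ?_
  simp only [List.length_append, hlen, List.length_singleton]
  constructor
  · intro h
    refine ⟨fun i hi hi' => h i (by omega) ?_, h e (by omega) ?_⟩
    · rw [List.getD_append _ _ _ _ (by rwa [hlen])]
      exact (hget x e i hi).2 hi'
    · rw [List.getD_append_right _ _ _ _ (by rw [hlen])]
      simp [hlen]
  · rintro ⟨h1, h2⟩ i hi hi'
    rcases Nat.lt_succ_iff_lt_or_eq.1 hi with hi | rfl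
    · rw [List.getD_append _ _ _ _ (by rwa [hlen])] at hi'
      exact h1 i hi ((hget x e i hi).1 hi')
    · exact h2

lemma UPred.chain {B : X → ℕ → Prop} {R : X → ℕ × ℕ → ℕ} {M : ℕ → ℕ} (hB : UPred o B)
    (hR : UComp o R) (hM : Primrec M) :
    UPred o fun x (p : ℕ × ℕ) => Chain (B x) (fun m y => R x (m, y)) M p.1 p.2 := by
  classical
  have hadm : UPred o fun x (p : (ℕ × ℕ) × ℕ) =>
      B x p.1.2 ∧ ∀ m < p.2, R x (m, p.1.2) = R x (m, p.1.1) := by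
    refine (hB.sub (Primrec.snd.comp Primrec.fst)).and (UPred.forall_lt
      (P := fun x (p : (ℕ × ℕ) × ℕ) => R x (p.2, p.1.2) = R x (p.2, p.1.1)) (UPred.eq ?_ ?_))
    · exact hR.sub (Primrec.pair Primrec.snd (Primrec.snd.comp Primrec.fst))
    · exact hR.sub (Primrec.pair Primrec.snd (Primrec.fst.comp Primrec.fst))
  have hw : UComp o fun x (p : ℕ × ℕ) => width (B x) (fun m y => R x (m, y)) M p.1 p.2 := by
    have hstep : UPred o fun x (p : ℕ × ℕ × ℕ) =>
        B x p.2.1 ∧ ∀ m < p.2.2, R x (m, p.2.1) = R x (m, p.1) :=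
      hadm.sub (h := fun p : ℕ × ℕ × ℕ => ((p.1, p.2.1), p.2.2)) (Primrec.pair
        (Primrec.pair Primrec.fst (Primrec.fst.comp Primrec.snd)) (Primrec.snd.comp Primrec.snd))
    refine (UComp.nat_rec (G := fun _ (_ : ℕ) => 0) (.const 0) (UComp.ite hstep
      (G := fun _ p => max p.2.2 (M p.2.1)) (H := fun _ p => p.2.2)
      (.of_primrec (Primrec.nat_max.comp (Primrec.snd.comp Primrec.snd)
        (hM.comp (Primrec.fst.comp Primrec.snd))))
      (.of_primrec (Primrec.snd.comp Primrec.snd)))).congr fun x ⟨y, t⟩ => ?_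
    induction t with
    | zero => rfl
    | succ t ih =>
      simp only at ih
      simp only [width, ← ih]
  refine (UPred.le (.of_primrec Primrec.snd) (.of_primrec Primrec.fst)).and ?_
  exact hadm.comp ((UComp.of_primrec Primrec.id).pair hw)

/-- The branch with top element `y`, as an oracle. -/
noncomputable def branchOracle (B : ℕ → Prop) (R : ℕ → ℕ → ℕ) (M : ℕ → ℕ) (f : Baire) (y : ℕ) :
    Baire := join f (charFn {t | Chain B R M y t})

lemma pre_branchOracle {B : ℕ → Prop} {R : ℕ → ℕ → ℕ} {M : ℕ → ℕ} {f : Baire} {z : ℕ}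
    {A : Set ℕ} (h : ∀ t < z, t ∈ A ↔ Chain B R M z t) :
    pre (join f (charFn A)) z = pre (branchOracle B R M f z) z := by
  refine pre_congr fun i hi => ?_
  simp only [branchOracle, join]
  split_ifs
  · rfl
  · classical
    exact if_congr (h (i / 2) (by omega)) rfl rfl

/-- There is an infinite prehomogeneous set whose jump is computable in the double jump. -/
theorem exists_prehomogeneous {B : X → ℕ → Prop} {R : X → ℕ × ℕ → ℕ} {M : ℕ → ℕ}
    (hB : UPred o B) (hR : UComp o R) (hM : Primrec M) (hinf : ∀ x, {y | B x y}.Infinite)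
    (hbd : ∀ x, ∃ k, ∀ m y, R x (m, y) < k) :
    ∃ A : X → Set ℕ, (∀ x, (A x).Infinite) ∧ (∀ x, ∀ z ∈ A x, B x z) ∧
      (∀ x, ∀ a ∈ A x, ∀ z ∈ A x, ∀ y ∈ A x, a < z → z ≤ y →
        ∀ m < M a, R x (m, z) = R x (m, y)) ∧
      UComp (fun x => turingJump (turingJump (o x)))
        fun x => turingJump (join (o x) (charFn (A x))) := by
  classical
  let C : X → ℕ → ℕ → Prop := fun x => Chain (B x) (fun m y => R x (m, y)) M
  have hC : UPred o fun x (p : ℕ × ℕ) => C x p.1 p.2 := .chain hB hR hM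
  let Z : X → ℕ → Baire := fun x y => branchOracle (B x) (fun m y => R x (m, y)) M (o x) y
  -- Even conditions keep a number off the branch, odd ones keep a computation from converging. Both
  -- are inherited by subbranches, the odd ones because the computation reads only the part of the
  -- branch below its top.
  let S : X → ℕ × ℕ → Prop := fun x p =>
    (p.1 % 2 = 0 ∧ ¬ C x p.2 (p.1 / 2)) ∨
      (p.1 % 2 ≠ 0 ∧ univApprox (pre (Z x p.2) p.2) (p.1 / 2).unpair = none)
  have hhalf : Primrec fun p : ℕ × ℕ => p.1 / 2 := Primrec.nat_div.comp Primrec.fst (.const 2)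
  have heven : UPred o fun _ (p : ℕ × ℕ) => p.1 % 2 = 0 :=
    .of_primrec (Primrec.eq.comp (Primrec.nat_mod.comp Primrec.fst (.const 2)) (.const 0))
  have hS : UPred o S := by
    refine (heven.and (hC.sub (h := fun p : ℕ × ℕ => (p.2, p.1 / 2))
      (Primrec.pair Primrec.snd hhalf)).not).or (heven.not.and ?_)
    have hpre : UComp o fun x (p : ℕ × ℕ) => pre (Z x p.2) p.2 := by
      have hz : UComp o fun x (q : (ℕ × ℕ) × ℕ) => Z x q.1.2 q.2 := by
        have h2 : Primrec fun q : (ℕ × ℕ) × ℕ => q.2 / 2 :=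
          Primrec.nat_div.comp Primrec.snd (.const 2)
        refine (UComp.ite (P := fun _ (q : (ℕ × ℕ) × ℕ) => q.2 % 2 = 0) (.of_primrec
          (Primrec.eq.comp (Primrec.nat_mod.comp Primrec.snd (.const 2)) (.const 0)))
          (UComp.oracle.sub h2) (UComp.ite (hC.sub (h := fun q : (ℕ × ℕ) × ℕ => (q.1.2, q.2 / 2))
            (Primrec.pair (Primrec.snd.comp Primrec.fst) h2)) (.const 1) (.const 0))).congr
              fun x q => ?_
        simp only [Z, branchOracle, join, charFn]
        rfl
      exact hz.list.sub (h := fun p : ℕ × ℕ => (p, p.2)) (Primrec.pair Primrec.id Primrec.snd)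
    exact UPred.eq (UComp.map₂ primrec_univApprox hpre
      (.of_primrec (Primrec.unpair.comp hhalf))) (.const none)
  obtain ⟨G, hG, hGr⟩ := exists_isGreedy hB hS
  have hSe : ∀ x z y, S x (2 * z, y) ↔ ¬ C x y z := fun x z y => by
    simp [S]
  have hSo : ∀ x z y, S x (2 * z + 1, y) ↔ univApprox (pre (Z x y) y) z.unpair = none := by
    intro x z y
    have h1 : (2 * z + 1) % 2 ≠ 0 := by omega
    have h2 : (2 * z + 1) / 2 = z := by omega
    simp [S, h2]
  have hlb : ∀ x, LimitBranch (B x) (fun m y => R x (m, y)) M (fun e y => S x (e, y)) (G x) := by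
    intro x
    refine ⟨fun N => ?_, hbd x, fun {y t} hc e he => ?_, fun z y => hSe x z y, hGr x⟩
    · obtain ⟨y, hy, hN⟩ := (hinf x).exists_gt N
      exact ⟨y, hN.le, hy⟩
    · rcases Nat.even_or_odd' e with ⟨z, rfl | rfl⟩
      · rw [hSe] at he ⊢
        exact fun h => he ((hc.iff h.1).1 h)
      · rw [hSo] at he ⊢
        have hp : pre (Z x y) t = pre (Z x t) t :=
          pre_branchOracle fun u hu => (hc.iff hu.le).symm
        rw [← hp]
        cases h : univApprox (pre (Z x y) t) z.unpair with
        | none => rfl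
        | some v => rw [mono_univApprox (pre_prefix hc.1) h] at he; cases he
  let A : X → Set ℕ := fun x => {z | ¬ G x (2 * z)}
  refine ⟨A, fun x => Set.infinite_of_not_bddAbove ?_, fun x z hz => (hlb x).base hz,
    fun x a ha z hz y hy h1 h2 => (hlb x).hom ha hz hy h1 h2, ?_⟩
  · rintro ⟨b, hb⟩
    obtain ⟨z, h1, h2⟩ := (hlb x).unbounded (b + 1)
    have := hb h2
    omega
  -- The jump is read off the odd decisions. A rejected condition fails at large elements of `A`,
  -- where the computation then converges on a true initial segment; an accepted one holds at every
  -- element of `A` and excludes convergence.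
  · refine UPred.ite_one_zero (P := fun x n => ¬ G x (2 * n + 1))
      (hG.sub Primrec.nat_double_succ).not fun x n => ?_
    have hpre : ∀ z ∈ A x, pre (join (o x) (charFn (A x))) z = pre (Z x z) z := fun z hz =>
      pre_branchOracle fun t ht => (hlb x).chain_iff hz ht.le
    constructor
    · intro hn
      obtain ⟨N, hN⟩ := (hlb x).eventually_not hn
      obtain ⟨z, h1, h2⟩ := (hlb x).unbounded N
      refine if_pos ⟨z, ?_⟩
      rw [hpre z h2, Option.isSome_iff_ne_none]
      exact fun h => hN z h1 h2 ((hSo x n z).2 h)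
    · intro hn
      refine if_neg ?_
      rintro ⟨s, hs⟩
      obtain ⟨z, h1, h2⟩ := (hlb x).unbounded s
      have h3 := (hSo x n z).1 ((hlb x).of_greedy h2 (not_not.1 hn))
      obtain ⟨v, hv⟩ := Option.isSome_iff_exists.1 hs
      have := mono_univApprox (pre_prefix h1) hv
      rw [hpre z h2, h3] at this
      cases this

end Compute

/-! ### Tuples -/

lemma append_mem_tuples {X : Set ℕ} {n : ℕ} {l : List ℕ} {y : ℕ} :
    l ++ [y] ∈ tuples X (n + 1) ↔ l ∈ tuples X n ∧ y ∈ X ∧ ∀ u ∈ l, u < y := by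
  simp only [tuples, Set.mem_ofPred_eq, List.length_append, List.length_singleton,
    List.pairwise_append, List.mem_append, List.mem_singleton, List.pairwise_singleton,
    Nat.add_right_cancel_iff]
  constructor
  · rintro ⟨h1, ⟨h2, -, h3⟩, h4⟩
    exact ⟨⟨h1, h2, fun x hx => h4 x (.inl hx)⟩, h4 y (.inr rfl), fun u hu => h3 u hu y rfl⟩
  · rintro ⟨⟨h1, h2, h3⟩, h4, h5⟩
    exact ⟨h1, ⟨h2, trivial, fun u hu v hv => hv ▸ h5 u hu⟩,
      fun x hx => hx.elim (h3 x) fun e => e ▸ h4⟩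

lemma tuples_mono {X Y : Set ℕ} (h : X ⊆ Y) (n : ℕ) : tuples X n ⊆ tuples Y n :=
  fun _ ⟨h1, h2, h3⟩ => ⟨h1, h2, fun x hx => h (h3 x hx)⟩

lemma exists_eq_append_of_mem_tuples {X : Set ℕ} {n : ℕ} {l : List ℕ} (h : l ∈ tuples X (n + 1)) :
    ∃ l' y, l = l' ++ [y] := by
  rcases List.eq_nil_or_concat' l with rfl | h'
  · simpa using h.1
  · exact h'

lemma singleton_mem_tuples {X : Set ℕ} {z : ℕ} : [z] ∈ tuples X 1 ↔ z ∈ X := by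
  simp [tuples]

lemma mem_tuples_one {X : Set ℕ} {l : List ℕ} (h : l ∈ tuples X 1) : ∃ z ∈ X, l = [z] := by
  obtain ⟨z, rfl⟩ := List.length_eq_one_iff.1 h.1
  exact ⟨z, h.2.2 z (by simp), rfl⟩

lemma length_le_of_pairwise {a : ℕ} {l : List ℕ} (h : l.Pairwise (· < ·)) (ha : ∀ u ∈ l, u ≤ a) :
    l.length ≤ a + 1 := by
  have hn : l.Nodup := h.imp fun h => h.ne
  rw [← List.toFinset_card_of_nodup hn, ← Finset.card_range (a + 1)]
  exact Finset.card_le_card fun u hu => by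
    have := ha u (List.mem_toFinset.1 hu)
    simp; omega

/-- A bound on the codes of increasing tuples of numbers up to `a`. -/
def codeBound (a : ℕ) : ℕ := Encodable.encode ((List.range (a + 1)).map fun _ => a) + 1

lemma primrec_codeBound : Primrec codeBound :=
  Primrec.succ.comp (Primrec.encode.comp (Primrec.list_map
    (Primrec.list_range.comp Primrec.succ) Primrec.fst))

lemma encode_le_replicate {a : ℕ} : ∀ {k : ℕ} {l : List ℕ}, l.length ≤ k → (∀ u ∈ l, u ≤ a) →
    Encodable.encode l ≤ Encodable.encode (List.replicate k a)
  | _, [], _, _ => by simp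
  | 0, _ :: _, h, _ => by simp at h
  | k + 1, u :: l, h, h' => by
    have h1 : u ≤ a := h' u (by simp)
    have h2 := encode_le_replicate (k := k) (l := l) (by simpa using h)
      fun v hv => h' v (by simp [hv])
    simp only [List.replicate_succ, Encodable.encode_list_cons, Encodable.encode_nat]
    refine Nat.succ_le_succ (le_trans (b := Nat.pair a (Encodable.encode l)) ?_ ?_)
    · rcases h1.lt_or_eq with h | rfl
      · exact (Nat.pair_lt_pair_left _ h).le
      · exact le_rfl
    · rcases h2.lt_or_eq with h | h
      · exact (Nat.pair_lt_pair_right _ h).le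
      · rw [h]

lemma encode_lt_codeBound {X : Set ℕ} {n a : ℕ} {l : List ℕ} (h : l ∈ tuples X n)
    (ha : ∀ u ∈ l, u ≤ a) : Encodable.encode l < codeBound a := by
  have := encode_le_replicate (length_le_of_pairwise h.2.1 ha) ha
  rw [codeBound, List.map_const', List.length_range]
  omega

section Compute

variable {X : Type} {o : X → Baire}

lemma UPred.forall_list {P : X → ℕ → Prop} (hP : UPred o P) :
    UPred o fun x (l : List ℕ) => ∀ u ∈ l, P x u := by
  have h := (UPred.forall_lt (P := fun x (p : List ℕ × ℕ) => P x (p.1.getD p.2 0))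
    (hP.sub (Primrec.list_getD 0))).sub (h := fun l : List ℕ => (l, l.length))
      (Primrec.pair Primrec.id Primrec.list_length)
  refine h.congr fun x l => ?_
  rw [List.forall_mem_iff_getElem]
  refine forall₂_congr fun i hi => ?_
  rw [List.getD_eq_getElem _ _ hi]

lemma primrecRel_forall_lt : PrimrecRel fun (l : List ℕ) (y : ℕ) => ∀ u ∈ l, u < y :=
  PrimrecRel.forall_mem_list Primrec.nat_lt

lemma UPred.mem_tuples {A : X → Set ℕ} (hA : UPred o fun x z => z ∈ A x) (n : ℕ) :
    UPred o fun x l => l ∈ tuples (A x) n := by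
  refine (UPred.of_primrec (Primrec.eq.comp Primrec.list_length (Primrec.const n))).and
    (UPred.and ?_ hA.forall_list)
  have h := ((UPred.of_primrec (o := o) (P := fun q : (List ℕ × ℕ) × ℕ =>
      q.1.1.getD q.2 0 < q.1.1.getD q.1.2 0) (Primrec.nat_lt.comp
        ((Primrec.list_getD 0).comp (Primrec.fst.comp Primrec.fst) Primrec.snd)
        ((Primrec.list_getD 0).comp (Primrec.fst.comp Primrec.fst)
          (Primrec.snd.comp Primrec.fst)))).forall_lt.sub
      (h := fun p : List ℕ × ℕ => (p, p.2)) (Primrec.pair Primrec.id Primrec.snd)).forall_lt.sub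
      (h := fun l : List ℕ => (l, l.length)) (Primrec.pair Primrec.id Primrec.list_length)
  refine h.congr fun x l => ?_
  rw [List.pairwise_iff_getElem]
  constructor
  · intro h i j hi hj hij
    have := h j hj i hij
    rwa [List.getD_eq_getElem _ _ hi, List.getD_eq_getElem _ _ hj] at this
  · intro h j hj i hij
    have hi : i < l.length := hij.trans hj
    simp only
    rw [List.getD_eq_getElem _ _ hi, List.getD_eq_getElem _ _ hj]
    exact h i j hi hj hij

/-! ### Candidates for the first-order part of Ramsey's theorem -/

/-- `b` and `rem` describe a nonempty set of numbers `y ≤ b`, namely those that are never removed,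
each of which is a value of `θ` on an infinite homogeneous subset of `A`. -/
structure IsCandidateSet (n : ℕ) (A : Set ℕ) (c : Baire) (θ : List ℕ → Option ℕ) (b : ℕ)
    (rem : ℕ × ℕ → Prop) : Prop where
  mono : ∀ y s t, s ≤ t → rem (y, s) → rem (y, t)
  nonempty : ∃ y ≤ b, ∀ s, ¬ rem (y, s)
  sound : ∀ y ≤ b, (∀ s, ¬ rem (y, s)) → ∃ H ⊆ A, H.Infinite ∧ IsHomogeneous n c H ∧
    ∃ s, θ (pre (charFn H) s) = some y

lemma exists_infinite_fiber {A : Set ℕ} (hA : A.Infinite) {c : ℕ → ℕ} {K : ℕ}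
    (hK : ∀ z ∈ A, c z ≤ K) : ∃ i ≤ K, {z | z ∈ A ∧ c z = i}.Infinite := by
  by_contra hcon
  push Not at hcon
  refine hA (((Set.finite_Iic K).biUnion fun i hi => hcon i hi).subset fun z hz => ?_)
  exact Set.mem_biUnion (hK z hz) ⟨hz, rfl⟩

/-- The finite string `σ` is an initial segment of a subset of `A` of color `i`. -/
def IsSegment (A : Set ℕ) (c : ℕ → ℕ) (i : ℕ) (σ : List ℕ) : Prop :=
  ∀ j < σ.length, σ.getD j 0 = 0 ∨ (σ.getD j 0 = 1 ∧ j ∈ A ∧ c j = i)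

/-- Beyond its length, `σ` is continued by all elements of `A` of color `i`. -/
lemma IsSegment.exists_infinite {A : Set ℕ} {c : ℕ → ℕ} {i : ℕ} {σ : List ℕ}
    (h : IsSegment A c i σ) (hinf : {z | z ∈ A ∧ c z = i}.Infinite) :
    ∃ H ⊆ A, H.Infinite ∧ (∀ z ∈ H, c z = i) ∧ pre (charFn H) σ.length = σ := by
  classical
  let H : Set ℕ := {z | if z < σ.length then σ.getD z 0 = 1 else z ∈ A ∧ c z = i}
  have hH : ∀ z, z ∈ H ↔ if z < σ.length then σ.getD z 0 = 1 else z ∈ A ∧ c z = i :=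
    fun z => Iff.rfl
  have hsub : ∀ z ∈ H, z ∈ A ∧ c z = i := by
    intro z hz
    rw [hH] at hz
    split_ifs at hz with hlt
    · rcases h z hlt with h0 | h1
      · omega
      · exact h1.2
    · exact hz
  refine ⟨H, fun z hz => (hsub z hz).1, ?_, fun z hz => (hsub z hz).2, ?_⟩
  · refine (hinf.sdiff (Set.finite_lt_nat σ.length)).mono fun z hz => ?_
    rw [hH, if_neg (show ¬ z < σ.length from hz.2)]
    exact hz.1
  · refine List.ext_getElem (by simp) fun j h1 h2 => ?_
    have hj : charFn H j = σ.getD j 0 := by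
      by_cases hm : j ∈ H
      · have := (hH j).1 hm
        rw [if_pos h2] at this
        simp only [charFn, if_pos hm, this]
      · have h3 : σ.getD j 0 ≠ 1 := fun h3 => hm ((hH j).2 (by rwa [if_pos h2]))
        simp only [charFn, if_neg hm]
        rcases h j h2 with h0 | h0
        · exact h0.symm
        · exact (h3 h0.1).elim
    simp only [pre, List.getElem_map, List.getElem_range, hj, List.getD_eq_getElem _ _ h2]

/-- The candidates are the values found for colors that occur infinitely often. Whether a color has
a value, and whether it no longer occurs beyond `s`, are one-quantifier questions for the jump. -/
lemma exists_candidateSet_one {A : X → Set ℕ} {c : X → Baire} {θ : X → List ℕ → Option ℕ}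
    (hA : UPred o fun x z => z ∈ A x) (hc : UComp o c) (hθ : UComp o θ)
    (hinf : ∀ x, (A x).Infinite) (hbd : ∀ x, ∃ k, ∀ l ∈ tuples (A x) 1, color (c x) l < k)
    (hconv : ∀ x, ∀ H ⊆ A x, H.Infinite → IsHomogeneous 1 (c x) H →
      ∃ s y, θ x (pre (charFn H) s) = some y) :
    ∃ (b : X → ℕ) (rem : X → ℕ × ℕ → Prop),
      UComp (fun x => turingJump (o x)) (fun x (_ : Unit) => b x) ∧
      UPred (fun x => turingJump (o x)) rem ∧
      ∀ x, IsCandidateSet 1 (A x) (c x) (θ x) (b x) (rem x) := by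
  classical
  let d : X → ℕ → ℕ := fun x z => color (c x) [z]
  have hd : UComp o d := hc.sub (Primrec.encode.comp
    (Primrec.list_cons.comp Primrec.id (Primrec.const [])))
  -- The number of colors is not part of the instance; the jump finds the least bound for the colors
  -- on `A`.
  obtain ⟨K, hK, hKs⟩ := UComp.exists_find (o := fun x => turingJump (o x))
    (P := fun x (p : Unit × ℕ) => ∀ z, z ∈ A x → d x z ≤ p.2)
    (UPred.jump_forall (P := fun x (q : (Unit × ℕ) × ℕ) => q.2 ∈ A x → d x q.2 ≤ q.1.2)
      ((hA.sub Primrec.snd).imp (.le (hd.sub Primrec.snd)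
        (.of_primrec (Primrec.snd.comp Primrec.fst)))))
    (fun x _ => by
      obtain ⟨k, hk⟩ := hbd x
      exact ⟨k, fun z hz => (hk [z] (singleton_mem_tuples.2 hz)).le⟩)
  have hof : Primrec (Denumerable.ofNat (List ℕ)) := Primrec.ofNat (List ℕ)
  have hseg : UPred o fun x (p : ℕ × ℕ) =>
      IsSegment (A x) (d x) p.1 (Denumerable.ofNat (List ℕ) p.2) := by
    have hg : Primrec fun q : (ℕ × List ℕ) × ℕ => q.1.2.getD q.2 0 :=
      (Primrec.list_getD 0).comp (Primrec.snd.comp Primrec.fst) Primrec.snd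
    have := (UPred.forall_lt (o := o) (P := fun x (q : (ℕ × List ℕ) × ℕ) =>
      q.1.2.getD q.2 0 = 0 ∨ (q.1.2.getD q.2 0 = 1 ∧ q.2 ∈ A x ∧ d x q.2 = q.1.1))
      ((UPred.of_primrec (Primrec.eq.comp hg (.const 0))).or
        ((UPred.of_primrec (Primrec.eq.comp hg (.const 1))).and ((hA.sub Primrec.snd).and
          (.eq (hd.sub Primrec.snd) (.of_primrec (Primrec.fst.comp Primrec.fst))))))).sub
      (h := fun p : ℕ × ℕ => ((p.1, Denumerable.ofNat (List ℕ) p.2),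
        (Denumerable.ofNat (List ℕ) p.2).length)) (Primrec.pair (Primrec.pair Primrec.fst
          (hof.comp Primrec.snd)) (Primrec.list_length.comp (hof.comp Primrec.snd)))
    exact this
  let P : X → ℕ × ℕ → Prop := fun x p => (θ x (Denumerable.ofNat (List ℕ) p.2)).isSome = true ∧
    IsSegment (A x) (d x) p.1 (Denumerable.ofNat (List ℕ) p.2)
  have hP : UPred o P := (UPred.of_bool (UComp.map Primrec.option_isSome
    (hθ.sub (hof.comp Primrec.snd)))).and hseg
  -- The guard makes the search succeed, with `0`, also for colors without a convergent segment.
  obtain ⟨m, hm, hms⟩ := UComp.exists_find (P := fun x (p : ℕ × ℕ) => (∃ k, P x (p.1, k)) → P x p)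
    ((hP.exists.sub Primrec.fst).imp hP.jump) (fun x i => by
      by_cases h : ∃ k, P x (i, k)
      · obtain ⟨k, hk⟩ := h
        exact ⟨k, fun _ => hk⟩
      · exact ⟨0, fun h' => (h h').elim⟩)
  -- Shifted by one: `0` stands for a color without value.
  let w : X → ℕ → ℕ := fun x i => if ∃ k, P x (i, k) then
    (θ x (Denumerable.ofNat (List ℕ) (m x i))).getD 0 + 1 else 0
  have hw : UComp (fun x => turingJump (o x)) w := by
    refine UComp.ite hP.exists ?_ (.const 0)
    exact UComp.map Primrec.succ (UComp.map (h := fun y : Option ℕ => y.getD 0)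
      (Primrec.option_getD.comp Primrec.id (Primrec.const 0)) (hθ.jump.comp (hm.map hof)))
  have hwle : UPred (fun x => turingJump (o x)) fun x (p : Unit × ℕ) =>
      ∀ i < K x p.1 + 1, w x i ≤ p.2 :=
    (UPred.forall_lt (P := fun x (q : ℕ × ℕ) => w x q.2 ≤ q.1) (.le (hw.sub Primrec.snd)
      (.of_primrec Primrec.fst))).comp (H := fun x (p : Unit × ℕ) => (p.2, K x p.1 + 1))
      ((UComp.of_primrec Primrec.snd).pair ((hK.sub Primrec.fst).map Primrec.succ))
  obtain ⟨b, hb, hbs⟩ := UComp.exists_find hwle (fun x u => by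
    refine ⟨(Finset.range (K x u + 1)).sup (w x), fun i hi => ?_⟩
    exact Finset.le_sup (Finset.mem_range.2 hi))
  let T : X → ℕ × ℕ → Prop := fun x p => ∀ z, p.2 < z → z ∈ A x → d x z ≠ p.1
  have hT : UPred (fun x => turingJump (o x)) T :=
    UPred.jump_forall (P := fun x (q : (ℕ × ℕ) × ℕ) => q.1.2 < q.2 → q.2 ∈ A x → d x q.2 ≠ q.1.1)
      ((UPred.lt (.of_primrec (Primrec.snd.comp Primrec.fst)) (.of_primrec Primrec.snd)).imp
        ((hA.sub Primrec.snd).imp (UPred.eq (hd.sub Primrec.snd)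
          (.of_primrec (Primrec.fst.comp Primrec.fst))).not))
  -- Several colors may yield the same value, so `y` is removed only when all of them are exhausted.
  -- A number that no color yields is removed at once.
  let rem : X → ℕ × ℕ → Prop := fun x p => ∀ i < K x () + 1, w x i = p.1 + 1 → T x (i, p.2)
  have hrem : UPred (fun x => turingJump (o x)) rem := by
    refine (UPred.forall_lt (P := fun x (q : (ℕ × ℕ) × ℕ) => w x q.2 = q.1.1 + 1 →
      T x (q.2, q.1.2)) ((UPred.eq (hw.sub Primrec.snd) (.of_primrec (Primrec.succ.comp
        (Primrec.fst.comp Primrec.fst)))).imp (hT.sub (Primrec.pair Primrec.snd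
          (Primrec.snd.comp Primrec.fst))))).comp (H := fun x p => (p, K x () + 1)) ?_
    exact (UComp.of_primrec Primrec.id).pair ((hK.sub (Primrec.const ())).map Primrec.succ)
  have hwi : ∀ x i y, w x i = y + 1 → ∃ σ, IsSegment (A x) (d x) i σ ∧ θ x σ = some y := by
    intro x i y h
    simp only [w] at h
    split_ifs at h with he
    obtain ⟨h1, h2⟩ := (hms x i).1 he
    refine ⟨_, h2, ?_⟩
    obtain ⟨v, hv⟩ := Option.isSome_iff_exists.1 h1
    rw [hv] at h ⊢
    simp only [Option.getD_some, Nat.add_right_cancel_iff] at h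
    rw [h]
  have hhom : ∀ x i H, (∀ z ∈ H, d x z = i) → IsHomogeneous 1 (c x) H := by
    intro x i H h
    refine ⟨i, fun l hl => ?_⟩
    obtain ⟨z, hz, rfl⟩ := mem_tuples_one hl
    exact h z hz
  refine ⟨fun x => b x (), rem, hb, hrem, fun x => ⟨?_, ?_, ?_⟩⟩
  · exact fun y s t hst h i hi hy z hz => h i hi hy z (lt_of_le_of_lt hst hz)
  · obtain ⟨i, hi, hinf'⟩ := exists_infinite_fiber (hinf x) (hKs x ()).1
    obtain ⟨s, y, hsy⟩ := hconv x _ (fun z hz => hz.1) hinf' (hhom x i _ fun z hz => hz.2)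
    have hex : ∃ k, P x (i, k) := by
      refine ⟨Encodable.encode (pre (charFn {z | z ∈ A x ∧ d x z = i}) s), ?_⟩
      simp only [P, Denumerable.ofNat_encode]
      refine ⟨by rw [hsy]; rfl, fun j hj => ?_⟩
      have hj' : j < s := by simpa using hj
      rw [List.getD_eq_getElem _ _ hj]
      simp only [pre, List.getElem_map, List.getElem_range, charFn]
      split_ifs with h
      · exact .inr ⟨rfl, h⟩
      · exact .inl rfl
    obtain ⟨y, hy⟩ : ∃ y, w x i = y + 1 := ⟨_, if_pos hex⟩
    refine ⟨y, ?_, fun s hr => ?_⟩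
    · have := (hbs x ()).1 i (Nat.lt_succ_of_le hi)
      simp only at this ⊢
      omega
    · obtain ⟨z, hz, hsz⟩ := hinf'.exists_gt s
      exact hr i (Nat.lt_succ_of_le hi) hy z hsz hz.1 hz.2
  · intro y _ hy
    -- If every color with value `y` were exhausted at some stage, the maximum of these stages would
    -- remove `y`.
    have : ∃ i < K x () + 1, w x i = y + 1 ∧ ∀ s, ¬ T x (i, s) := by
      by_contra hcon
      push Not at hcon
      have h' : ∀ i, ∃ s, i < K x () + 1 → w x i = y + 1 → T x (i, s) := by
        intro i
        by_cases hi : i < K x () + 1 ∧ w x i = y + 1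
        · obtain ⟨s, hs⟩ := hcon i hi.1 hi.2
          exact ⟨s, fun _ _ => hs⟩
        · exact ⟨0, fun h1 h2 => (hi ⟨h1, h2⟩).elim⟩
      choose s hs using h'
      refine hy ((Finset.range (K x () + 1)).sup s) fun i hi hi' z hz => ?_
      exact hs i hi hi' z (lt_of_le_of_lt (Finset.le_sup (f := s) (Finset.mem_range.2 hi)) hz)
    obtain ⟨i, -, hi, hT'⟩ := this
    obtain ⟨σ, h1, h2⟩ := hwi x i y hi
    obtain ⟨H, k1, k2, k3, k4⟩ := h1.exists_infinite (Set.infinite_of_not_bddAbove (by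
      rintro ⟨s, hs⟩
      refine hT' s fun z hz hzA hzi => ?_
      have : z ≤ s := hs ⟨hzA, hzi⟩
      omega))
    exact ⟨H, k1, k2, hhom x i H k3, σ.length, by rw [k4, h2]⟩

/-- The numbers that Ramsey's theorem for `(n + 1)`-tuples can be asked for have a nonempty set of
candidates whose complement is enumerable, within a bound, in the `(n + 1)`-st jump. -/
theorem exists_candidateSet (n : ℕ) : ∀ {o : X → Baire} {A : X → Set ℕ} {c : X → Baire}
    {θ : X → List ℕ → Option ℕ}, UPred o (fun x z => z ∈ A x) → UComp o c → UComp o θ →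
    (∀ x, (A x).Infinite) → (∀ x, ∃ k, ∀ l ∈ tuples (A x) (n + 1), color (c x) l < k) →
    (∀ x, ∀ H ⊆ A x, H.Infinite → IsHomogeneous (n + 1) (c x) H →
      ∃ s y, θ x (pre (charFn H) s) = some y) →
    ∃ (b : X → ℕ) (rem : X → ℕ × ℕ → Prop),
      UComp (fun x => turingJump^[n + 1] (o x)) (fun x (_ : Unit) => b x) ∧
      UPred (fun x => turingJump^[n + 1] (o x)) rem ∧
      ∀ x, IsCandidateSet (n + 1) (A x) (c x) (θ x) (b x) (rem x) := by
  classical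
  induction n with
  | zero => exact exists_candidateSet_one
  | succ n ih =>
    intro o A c θ hA hc hθ hinf hbd hconv
    have hof : Primrec (Denumerable.ofNat (List ℕ)) := Primrec.ofNat (List ℕ)
    -- The first argument codes a tuple and the second is a proposed last element. Agreement of `R`
    -- below `codeBound a` thus means agreement on all tuples with entries at most `a`.
    let R : X → ℕ × ℕ → ℕ := fun x p =>
      if Denumerable.ofNat (List ℕ) p.1 ++ [p.2] ∈ tuples (A x) (n + 2) then
        color (c x) (Denumerable.ofNat (List ℕ) p.1 ++ [p.2]) else 0
    have hcat : Primrec fun p : ℕ × ℕ => Denumerable.ofNat (List ℕ) p.1 ++ [p.2] :=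
      Primrec.list_concat.comp (hof.comp Primrec.fst) Primrec.snd
    have hR : UComp o R := .ite ((hA.mem_tuples (n + 2)).sub hcat)
      (hc.sub (Primrec.encode.comp hcat)) (.const 0)
    obtain ⟨A', hA'inf, hA'A, hA'hom, hA'J⟩ := exists_prehomogeneous hA hR primrec_codeBound hinf
      (fun x => by
        obtain ⟨k, hk⟩ := hbd x
        refine ⟨k + 1, fun m y => ?_⟩
        simp only [R]
        split_ifs with h
        · exact (hk _ h).trans (Nat.lt_succ_self k)
        · exact Nat.succ_pos k)
    let o' : X → Baire := fun x => join (o x) (charFn (A' x))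
    have ho' : UComp o' o := .join_left
    have hA' : UPred o' fun x z => z ∈ A' x :=
      (UPred.eq UComp.join_right (.const 1)).congr fun x z => by simp [charFn]
    -- The least element of `A'` above a tuple serves as the canonical last element and defines a
    -- coloring of tuples shorter by one.
    obtain ⟨next, hnext, hns⟩ := UComp.exists_find
      (P := fun x (p : List ℕ × ℕ) => p.2 ∈ A' x ∧ ∀ u ∈ p.1, u < p.2)
      ((hA'.sub Primrec.snd).and (.of_primrec primrecRel_forall_lt)) (fun x l => by
        obtain ⟨z, hz, hlt⟩ := (hA'inf x).exists_gt l.sum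
        exact ⟨z, hz, fun u hu => (List.single_le_sum (by simp) u hu).trans_lt hlt⟩)
    let d : X → Baire := fun x m => color (c x)
      (Denumerable.ofNat (List ℕ) m ++ [next x (Denumerable.ofNat (List ℕ) m)])
    have hd : UComp o' d := (ho'.trans hc).comp (UComp.map Primrec.encode
      (UComp.map₂ (h := fun (l : List ℕ) (y : ℕ) => l ++ [y]) Primrec.list_concat
        (.of_primrec hof) (hnext.sub hof)))
    have hdl : ∀ x l, color (d x) l = color (c x) (l ++ [next x l]) := fun x l => by
      simp [color, d]
    have hhom : ∀ x, ∀ H ⊆ A' x, IsHomogeneous (n + 1) (d x) H →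
        IsHomogeneous (n + 2) (c x) H := by
      rintro x H hH ⟨i, hi⟩
      refine ⟨i, fun l hl => ?_⟩
      obtain ⟨l, y, rfl⟩ := exists_eq_append_of_mem_tuples hl
      obtain ⟨hl1, hy, hly⟩ := append_mem_tuples.1 hl
      obtain ⟨l', a, rfl⟩ := exists_eq_append_of_mem_tuples hl1
      obtain ⟨hl2, ha, hla⟩ := append_mem_tuples.1 hl1
      obtain ⟨⟨hz1, hz2⟩, hz3⟩ := hns x (l' ++ [a])
      have haz := hz2 a (by simp)
      have hzy : next x (l' ++ [a]) ≤ y := by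
        by_contra hlt
        exact hz3 y (by omega) ⟨hH hy, hly⟩
      have hcode := encode_lt_codeBound hl1 (a := a) (fun u hu => by
        rcases List.mem_append.1 hu with hu | hu
        · exact (hla u hu).le
        · exact (List.mem_singleton.1 hu).le)
      -- Prehomogeneity: beyond the largest entry `a`, the canonical last element and the actual one
      -- give the same color.
      have hRR := hA'hom x a (hH ha) _ hz1 y (hH hy) haz hzy _ hcode
      have hsub : H ⊆ A x := fun z hz => hA'A x z (hH hz)
      simp only [R, Denumerable.ofNat_encode] at hRR
      rw [if_pos (append_mem_tuples.2 ⟨tuples_mono hsub _ hl1, hA'A x _ hz1, hz2⟩),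
        if_pos (tuples_mono hsub _ hl)] at hRR
      rw [← hRR, ← hdl]
      exact hi _ hl1
    obtain ⟨b, rem, hb, hrem, hcand⟩ := ih hA' hd (ho'.trans hθ) hA'inf (fun x => by
        obtain ⟨k, hk⟩ := hbd x
        refine ⟨k, fun l hl => ?_⟩
        rw [hdl]
        exact hk _ (append_mem_tuples.2 ⟨tuples_mono (hA'A x) _ hl,
          hA'A x _ (hns x l).1.1, (hns x l).1.2⟩))
      (fun x H hH hHinf hHhom => hconv x H (hH.trans (hA'A x)) hHinf (hhom x H hH hHhom))
    -- The first jump of `o ⊕ A'` costs two jumps of `o`; each of the `n` remaining ones costs one.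
    have htr : UComp (fun x => turingJump^[n + 2] (o x)) fun x => turingJump^[n + 1] (o' x) :=
      iterate_turingJump_mono (o := fun x => turingJump (turingJump (o x)))
        (g := fun x => turingJump (o' x)) hA'J n
    refine ⟨b, rem, htr.trans hb, htr.trans hrem, fun x =>
      ⟨(hcand x).mono, (hcand x).nonempty, fun y hy hy' => ?_⟩⟩
    obtain ⟨H, h1, h2, h3, h4⟩ := (hcand x).sound y hy hy'
    exact ⟨H, h1.trans (hA'A x), h2, hhom x H h1 h3, h4⟩

end Compute

/-! ### Finite parallelization -/

lemma finJoin_zero (k : ℕ) (fs : Fin k → Baire) : finJoin k fs 0 = k := rfl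

lemma finJoin_odd (k : ℕ) (fs : Fin k → Baire) (i j : ℕ) :
    finJoin k fs (2 * Nat.pair i j + 1) = if h : i < k then fs ⟨i, h⟩ j else 0 := by
  simp [finJoin]

lemma finJoin_inj {k : ℕ} {fs gs : Fin k → Baire} (h : finJoin k fs = finJoin k gs) : fs = gs := by
  funext i j
  have := congrFun h (2 * Nat.pair i j + 1)
  simpa [finJoin_odd] using this

lemma mem_star_sol {P : Problem} {k : ℕ} {fs : Fin k → Baire} {g : Baire}
    (h : g ∈ P.star.sol (finJoin k fs)) :
    ∃ gs : Fin k → Baire, (∀ i, gs i ∈ P.sol (fs i)) ∧ g = finJoin k gs := by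
  obtain ⟨k', -, fs', he, gs, hgs, hg⟩ := h
  obtain rfl : k = k' := congrFun he 0
  obtain rfl := finJoin_inj he
  exact ⟨gs, hgs, hg⟩

section Compute

variable {X : Type} {o : X → Baire}

lemma UComp.finJoin {k : X → ℕ} {G : X → ℕ × ℕ → ℕ} (hk : UComp o fun x (_ : Unit) => k x)
    (hG : UComp o G) : UComp o fun x => finJoin (k x) fun i j => G x (i, j) := by
  have h : UComp o fun x (n : ℕ) => if n.unpair.1 < k x then G x n.unpair else 0 :=
    (UComp.ite (P := fun x (n : ℕ) => n.unpair.1 < k x)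
      (.lt (.of_primrec (Primrec.fst.comp Primrec.unpair)) (hk.sub (Primrec.const ())))
      (hG.sub Primrec.unpair) (.const 0)).congr fun x n => by congr
  refine (hk.ofNum.prod h).congr fun x n => ?_
  simp only [Weihrauch.finJoin, join]
  split_ifs <;> rfl

end Compute

/-! ### Enumerations of proper subsets of `{0, 1}` -/

/-- The enumeration that repeats the first value of `u` other than `2`. -/
def latch (u : ℕ → ℕ) : Baire
  | 0 => u 0
  | s + 1 => if latch u s = 2 then u (s + 1) else latch u s

lemma latch_persist {u : ℕ → ℕ} {s t : ℕ} (h : latch u s ≠ 2) (hst : s ≤ t) :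
    latch u t = latch u s := by
  induction t, hst using Nat.le_induction with
  | base => rfl
  | succ t _ ih => rw [latch, ih, if_neg h]

lemma latch_mem {u : ℕ → ℕ} {p : ℕ → Prop} (h : ∀ s, p (u s)) (s : ℕ) : p (latch u s) := by
  induction s with
  | zero => exact h 0
  | succ s ih =>
    rw [latch]
    split_ifs
    · exact h _
    · exact ih

lemma latch_eq {u : ℕ → ℕ} {s : ℕ} (h : ∀ t < s, u t = 2) : latch u s = u s := by
  cases s with
  | zero => rfl
  | succ s => rw [latch, latch_eq fun t ht => h t (ht.trans s.lt_succ_self), h s s.lt_succ_self,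
      if_pos rfl]

lemma mem_range_latch {u : ℕ → ℕ} {i : ℕ} (h : ∀ s, u s = i ∨ u s = 2) 
    (hex : ∃ s, u s = i) : i ∈ Set.range (latch u) := by
  classical
  have hs := Nat.find_spec hex
  refine ⟨Nat.find hex, (latch_eq fun t ht => ?_).trans hs⟩
  exact (h t).resolve_left (Nat.find_min hex ht)

/-- A latched sequence takes at most one value other than `2`, so it cannot enumerate both `0` and
`1`. -/
lemma latch_mem_dom {u : ℕ → ℕ} (h : ∀ s, u s ≤ 2) : latch u ∈ (C 2).dom := by
  refine ⟨fun s => Nat.lt_succ_of_le (latch_mem (p := (· ≤ 2)) h s), ?_, fun s t hst hne ht => ?_,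
    fun s r t hsr hrt he => ?_⟩
  · by_cases h0 : 0 ∈ Set.range (latch u)
    · refine ⟨1, by norm_num, ?_⟩
      rintro ⟨t, ht⟩
      obtain ⟨s, hs⟩ := h0
      rcases le_total s t with hst | hst
      · have := latch_persist (u := u) (s := s) (by omega) hst
        omega
      · have := latch_persist (u := u) (s := t) (by omega) hst
        omega
    · exact ⟨0, by norm_num, h0⟩
  · by_cases hs : latch u s = 2
    · exact hne (hs.trans ht.symm)
    · exact hne (latch_persist hs hst.le).symm
  · by_cases hr : latch u r = 2
    · by_contra hne
      have hs : latch u s ≠ 2 := fun hs => hne (hs.trans hr.symm)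
      exact hne (latch_persist hs hsr.le).symm
    · by_cases hs : latch u s = 2
      · have := latch_persist hr hrt.le
        exact (hr (this ▸ he ▸ hs)).elim
      · exact (latch_persist hs hsr.le).symm

/-- The sequence whose first value other than `2` is the first of `{m}` and `{m + 1, …, b}` to be
exhausted. -/
noncomputable def exhaust (b : ℕ) (rem : ℕ × ℕ → Prop) (m s : ℕ) : ℕ :=
  open Classical in
  -- For `m = b` the first condition is vacuous, so `1` is enumerated immediately and the only
  -- solution is `0`.
  if ∀ y < b + 1, m < y → rem (y, s) then 1 else if rem (m, s) then 0 else 2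

lemma exhaust_le (b : ℕ) (rem : ℕ × ℕ → Prop) (m s : ℕ) : exhaust b rem m s ≤ 2 := by
  rw [exhaust]
  split_ifs <;> omega

/-- Solutions to the choice problems given by a candidate set determine a candidate. -/
lemma candidate_of_choice {b : ℕ} {rem : ℕ × ℕ → Prop}
    (hmono : ∀ y s t, s ≤ t → rem (y, s) → rem (y, t)) (hne : ∃ y ≤ b, ∀ s, ¬ rem (y, s))
    {a : ℕ → ℕ} (ha : ∀ m ≤ b, a m < 2 ∧ a m ∉ Set.range (latch (exhaust b rem m))) {y : ℕ}
    (hy : a y = 0) (hmin : ∀ m < y, a m ≠ 0) : y ≤ b ∧ ∀ s, ¬ rem (y, s) := by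
  -- Invariant: as long as all earlier answers are `1`, some surviving candidate is at least `m`.
  have halive : ∀ m ≤ y, ∃ z, m ≤ z ∧ z ≤ b ∧ ∀ s, ¬ rem (z, s) := by
    intro m
    induction m with
    | zero => exact fun _ => by simpa using hne
    | succ m ih =>
      intro hm
      obtain ⟨z, h1, h2, h3⟩ := ih (by omega)
      by_contra hcon
      push Not at hcon
      obtain rfl : m = z := by
        by_contra h
        obtain ⟨s, hs⟩ := hcon z (by omega) h2
        exact h3 s hs
      have ham : a m = 1 := by
        have := hmin m (by omega)
        have := (ha m h2).1
        omega
      -- Here `m` survives and everything above it is removed, so `1` is enumerated, against the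
      -- answer `1`.
      refine (ha m h2).2 (ham ▸ mem_range_latch (fun s => ?_) ?_)
      · rw [exhaust]
        split_ifs with h h'
        · exact .inl rfl
        · exact (h3 s h').elim
        · exact .inr rfl
      · have : ∀ z, ∃ s, m < z → z ≤ b → rem (z, s) := by
          intro z
          by_cases hz : m < z ∧ z ≤ b
          · obtain ⟨s, hs⟩ := hcon z hz.1 hz.2
            exact ⟨s, fun _ _ => hs⟩
          · exact ⟨0, fun h h' => (hz ⟨h, h'⟩).elim⟩
        choose f hf using this
        refine ⟨(Finset.range (b + 1)).sup f, if_pos fun z hz hmz => ?_⟩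
        exact hmono z _ _ (Finset.le_sup (f := f) (Finset.mem_range.2 hz)) (hf z hmz (by omega))
  obtain ⟨z, h1, h2, h3⟩ := halive y le_rfl
  refine ⟨h1.trans h2, fun s hs => ?_⟩
  -- If `y` were removed, the survivor `z` would lie above it, the first alternative would never
  -- apply, and `0` would be enumerated, against the answer `0`.
  have hyz : y < z := h1.lt_of_ne fun h => h3 s (h ▸ hs)
  have hno : ∀ s, ¬ ∀ x < b + 1, y < x → rem (x, s) := fun s h => h3 s (h z (by omega) hyz)
  refine (ha y (h1.trans h2)).2 (hy ▸ mem_range_latch (fun s => ?_) ⟨s, ?_⟩)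
  · rw [exhaust, if_neg (hno s)]
    split_ifs
    · exact .inl rfl
    · exact .inr rfl
  · rw [exhaust, if_neg (hno s), if_pos hs]

section Compute

variable {X : Type} {o : X → Baire}

lemma UComp.latched {α : Type*} [Primcodable α] {u : X → α × ℕ → ℕ} (hu : UComp o u) :
    UComp o fun x (p : α × ℕ) => latch (fun s => u x (p.1, s)) p.2 := by
  classical
  refine (UComp.nat_rec (G := fun x a => u x (a, 0))
    (H := fun x (q : α × ℕ × ℕ) => if q.2.2 = 2 then u x (q.1, q.2.1 + 1) else q.2.2)
    (hu.sub (Primrec.pair Primrec.id (Primrec.const 0))) ?_).congr fun x ⟨a, s⟩ => ?_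
  · refine (UComp.ite (P := fun _ (q : α × ℕ × ℕ) => q.2.2 = 2)
      (.of_primrec (Primrec.eq.comp (Primrec.snd.comp Primrec.snd) (Primrec.const 2)))
      (hu.sub (h := fun q : α × ℕ × ℕ => (q.1, q.2.1 + 1)) (Primrec.pair Primrec.fst
        (Primrec.succ.comp (Primrec.fst.comp Primrec.snd))))
      (.of_primrec (Primrec.snd.comp Primrec.snd))).congr fun x q => by congr
  · induction s with
    | zero => rfl
    | succ s ih =>
      simp only at ih ⊢
      rw [latch, ← ih]

lemma UComp.latch_exhaust {b : X → ℕ} {rem : X → ℕ × ℕ → Prop}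
    (hb : UComp o fun x (_ : Unit) => b x) (hrem : UPred o rem) :
    UComp o fun x (p : ℕ × ℕ) => latch (exhaust (b x) (rem x) p.1) p.2 := by
  classical
  have hu : UComp o fun x (p : ℕ × ℕ) => exhaust (b x) (rem x) p.1 p.2 := by
    refine (UComp.ite (P := fun x (p : ℕ × ℕ) => ∀ y < b x + 1, p.1 < y → rem x (y, p.2)) ?_
      (.const 1) (.ite hrem (.const 0) (.const 2))).congr fun x p => by
        rw [exhaust]
        congr
    refine (UPred.forall_lt (P := fun x (q : (ℕ × ℕ) × ℕ) => q.1.1 < q.2 → rem x (q.2, q.1.2))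
      ((UPred.of_primrec (Primrec.nat_lt.comp (Primrec.fst.comp Primrec.fst) Primrec.snd)).imp
        (hrem.sub (Primrec.pair Primrec.snd (Primrec.snd.comp Primrec.fst))))).comp
      (H := fun x (p : ℕ × ℕ) => (p, b x + 1)) ?_
    exact (UComp.of_primrec Primrec.id).pair ((hb.sub (Primrec.const ())).map Primrec.succ)
  exact hu.latched

end Compute

/-! ### The upper bound for the first-order part of Ramsey's theorem -/

/-- The approximation to `Ψ(⟨f, H⟩)(0)` from an initial segment of `H`. -/
def valueApprox (f : Baire) (Ψ : ℕ) (σ : List ℕ) : Option ℕ :=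
  univApprox (pre (join f fun j => σ.getD j 0) σ.length) (Ψ, 0)

lemma exists_valueApprox {f g : Baire} {Ψ y : ℕ} :
    (∃ s, valueApprox f Ψ (pre g s) = some y) ↔ y ∈ functional Ψ (join f g) 0 := by
  rw [mem_functional]
  refine exists_congr fun s => ?_
  have : pre (join f fun j => (pre g s).getD j 0) s = pre (join f g) s := by
    refine pre_congr fun i hi => ?_
    simp only [join]
    split_ifs
    · rfl
    · have : i / 2 < s := by omega
      simp [List.getD, getElem?_pre this]
  rw [valueApprox, length_pre, this]

/-- Candidates for the value of `Ψ` come from `exists_candidateSet` with `A` all of `ω`; the choice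
among them is encoded in latched enumerations. -/
theorem firstOrderPart_rTNat_le (n : ℕ) :
    WeihrauchLE (RTNat (n + 1)).firstOrderPart ((C 2).star.iterJump (n + 1)) := by
  choose f Φ Ψ hx p hp hΦ hΨ using fun x : (RTNat (n + 1)).firstOrderPart.dom => x.2
  let o : (RTNat (n + 1)).firstOrderPart.dom → Baire := fun x => x.1
  have h0 : UComp o fun x => join (f x) (join (ofNum (Φ x)) (ofNum (Ψ x))) :=
    UComp.oracle.congr fun x m => by conv_lhs => rw [show o x = _ from hx x]
  have hpc : UComp o p := .of_computes h0.left (h0.right.left.apply 0) hΦ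
  have hθ : UComp o fun x => valueApprox (f x) (Ψ x) := by
    have h2 : Primrec fun q : List ℕ × ℕ => q.2 / 2 := Primrec.nat_div.comp Primrec.snd (.const 2)
    have hj : UComp o fun x (q : List ℕ × ℕ) => join (f x) (fun j => q.1.getD j 0) q.2 := by
      refine (UComp.ite (P := fun _ (q : List ℕ × ℕ) => q.2 % 2 = 0) (.of_primrec (Primrec.eq.comp
        (Primrec.nat_mod.comp Primrec.snd (Primrec.const 2)) (Primrec.const 0)))
        (h0.left.sub h2) (H := fun _ q => q.1.getD (q.2 / 2) 0)
        (.of_primrec ((Primrec.list_getD 0).comp Primrec.fst h2))).congr fun x q => ?_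
      simp [join]
    exact UComp.map₂ primrec_univApprox (hj.list.sub (h := fun σ : List ℕ => (σ, σ.length))
      (Primrec.pair Primrec.id Primrec.list_length)) ((h0.right.right.apply 0).pair (.const 0))
  have hsol : ∀ x (H : Set ℕ), H.Infinite → IsHomogeneous (n + 1) (p x) H →
      charFn H ∈ (RTNat (n + 1)).sol (p x) := fun x H h1 h2 => by
    obtain ⟨k, hk, hc⟩ := hp x
    exact ⟨k, hk, hc, H, h1, h2, rfl⟩
  obtain ⟨b, rem, hb, hrem, hcand⟩ := exists_candidateSet n (A := fun _ => Set.univ)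
    (UPred.of_primrec ⟨inferInstance, (Primrec.const true).of_eq fun _ => by simp⟩) hpc hθ
    (fun _ => Set.infinite_univ) (fun x => by
      obtain ⟨k, -, hk⟩ := hp x
      exact ⟨k, hk⟩)
    (fun x H _ h1 h2 => by
      obtain ⟨y, hy⟩ := Part.dom_iff_mem.1 (hΨ x _ (hsol x H h1 h2))
      obtain ⟨s, hs⟩ := exists_valueApprox.2 hy
      exact ⟨s, y, hs⟩)
  -- The number `b + 1` of parallel instances is available only in the `(n + 1)`-st jump, which is
  -- why the parallelization stands inside the jumps.
  obtain ⟨r, hr, hrd⟩ := exists_iterJump (C 2).star (n + 1)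
    ((UComp.finJoin (k := fun x => b x + 1) (hb.map Primrec.succ) (.latch_exhaust hb hrem)))
    (fun x => ⟨b x + 1, by omega, _, fun i => latch_mem_dom fun s => exhaust_le _ _ _ s, rfl⟩)
  have hdec : ∀ y : {y : (RTNat (n + 1)).firstOrderPart.dom × Baire //
      y.2 ∈ ((C 2).star.iterJump (n + 1)).sol (r y.1)}, ∃ a : ℕ → ℕ,
      (∀ m, a m = y.1.2 (2 * Nat.pair m 0 + 1)) ∧ (∀ m, b y.1.1 < m → a m = 0) ∧
      ∀ m ≤ b y.1.1, a m < 2 ∧ a m ∉ Set.range (latch (exhaust (b y.1.1) (rem y.1.1) m)) := by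
    rintro ⟨⟨x, g⟩, hg⟩
    obtain ⟨gs, hgs, hg'⟩ := mem_star_sol ((hrd x).2 hg)
    obtain rfl : g = finJoin (b x + 1) gs := hg'
    refine ⟨fun m => finJoin (b x + 1) gs (2 * Nat.pair m 0 + 1), fun m => rfl, fun m hm => ?_, fun m hm => ?_⟩
    · have hm' : ¬ m < b x + 1 := by
        have : b x < m := hm
        omega
      simp only [finJoin_odd, dif_neg hm']
    · have hm' : m < b x + 1 := Nat.lt_succ_of_le hm
      obtain ⟨i, hi, hir, hgi⟩ := hgs ⟨m, hm'⟩
      simp only [finJoin_odd, dif_pos hm', hgi, ofNum_zero_apply]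
      exact ⟨hi, hir⟩
  -- The search does not use `b`: a coded tuple is `0` beyond its length, so a zero is always found.
  obtain ⟨v, hv, hvs⟩ := UComp.exists_find
    (P := fun (y : {y : (RTNat (n + 1)).firstOrderPart.dom × Baire //
      y.2 ∈ ((C 2).star.iterJump (n + 1)).sol (r y.1)}) (q : Unit × ℕ) =>
      y.1.2 (2 * Nat.pair q.2 0 + 1) = 0)
    (UPred.eq ((UComp.join_right (f := fun y => y.1.1.1)).sub (Primrec.nat_double_succ.comp
      (Primrec₂.natPair.comp Primrec.snd (.const 0)))) (.const 0)) (fun y _ => by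
        obtain ⟨a, h1, h2, -⟩ := hdec y
        exact ⟨b y.1.1 + 1, by rw [← h1, h2 _ (Nat.lt_succ_self _)]⟩)
  refine weihrauchLE_iff.2 ⟨r, hr, fun x => (hrd x).1, fun y => ofNum (v y ()), hv.ofNum,
    fun y => ?_⟩
  obtain ⟨a, h1, -, h3⟩ := hdec y
  have hc := hcand y.1.1
  obtain ⟨h4, h5⟩ := candidate_of_choice hc.mono hc.nonempty h3 (y := v y ())
    (by rw [h1, (hvs y ()).1]) (fun m hm => by rw [h1]; exact (hvs y ()).2 m hm)
  obtain ⟨H, -, k2, k3, k4⟩ := hc.sound _ h4 h5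
  exact ⟨_, _, _, hx y.1.1, _, hp y.1.1, hΦ y.1.1, charFn H, hsol _ H k2 k3, _,
    exists_valueApprox.1 k4, rfl⟩


open Filter

/-! ### Iterated limits -/

/-- `P` holds of `[s₁, …, sₙ]` for all large `s₁`, for all large `s₂`, and so on. -/
def EventuallyIter : ℕ → (List ℕ → Prop) → Prop
  | 0, P => P []
  | n + 1, P => ∀ᶠ s in atTop, EventuallyIter n fun l => P (s :: l)

lemma EventuallyIter.mono {n : ℕ} {P Q : List ℕ → Prop} (hP : EventuallyIter n P)
    (h : ∀ l, P l → Q l) : EventuallyIter n Q := by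
  induction n generalizing P Q with
  | zero => exact h _ hP
  | succ n ih => exact Eventually.mono hP fun s hs => ih hs fun l => h _

lemma eventuallyIter_of_forall {n : ℕ} {P : List ℕ → Prop} (h : ∀ l, P l) : EventuallyIter n P := by
  induction n generalizing P with
  | zero => exact h _
  | succ n ih => exact Eventually.of_forall fun s => ih fun l => h _

lemma EventuallyIter.and {n : ℕ} {P Q : List ℕ → Prop} (hP : EventuallyIter n P)
    (hQ : EventuallyIter n Q) : EventuallyIter n fun l => P l ∧ Q l := by
  induction n generalizing P Q with
  | zero => exact ⟨hP, hQ⟩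
  | succ n ih =>
    filter_upwards [hP, hQ] with s hs ht
    exact ih hs ht

lemma EventuallyIter.forall_le {n : ℕ} {P : ℕ → List ℕ → Prop}
    (h : ∀ x, EventuallyIter n (P x)) (N : ℕ) : EventuallyIter n fun l => ∀ x ≤ N, P x l := by
  induction N with
  | zero => exact (h 0).mono fun l hl x hx => by rwa [Nat.le_zero.1 hx]
  | succ N ih =>
    refine (ih.and (h (N + 1))).mono fun l hl x hx => ?_
    rcases hx.lt_or_eq with hx | rfl
    · exact hl.1 x (by omega)
    · exact hl.2

lemma EventuallyIter.snoc {n : ℕ} {P : List ℕ → Prop}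
    (h : EventuallyIter n fun l => ∀ᶠ s in atTop, P (l ++ [s])) : EventuallyIter (n + 1) P := by
  induction n generalizing P with
  | zero => exact h
  | succ n ih => exact Eventually.mono h fun s hs => ih hs

lemma eventuallyIter_le_head (n N : ℕ) : EventuallyIter (n + 1) fun l => N ≤ l.headI := by
  filter_upwards [eventually_ge_atTop N] with s hs
  exact eventuallyIter_of_forall fun _ => hs

/-- An infinite set meets every final segment, so the coordinates can be chosen in turn. A lower
bound on the entries is carried along to keep the tuple increasing. -/
lemma EventuallyIter.exists_tuple {n : ℕ} {P : List ℕ → Prop} (h : EventuallyIter n P) {H : Set ℕ}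
    (hH : H.Infinite) : ∃ l ∈ tuples H n, P l := by
  suffices hs : ∀ a, ∃ l ∈ tuples H n, (∀ u ∈ l, a < u) ∧ P l by
    obtain ⟨l, h1, -, h2⟩ := hs 0
    exact ⟨l, h1, h2⟩
  induction n generalizing P with
  | zero => exact fun a => ⟨[], by simp [tuples], by simp, h⟩
  | succ n ih =>
    intro a
    obtain ⟨N, hN⟩ := eventually_atTop.1 h
    obtain ⟨s, hs, hlt⟩ := hH.exists_gt (max a N)
    obtain ⟨l, ⟨h1, h2, h3⟩, h4, h5⟩ := ih (hN s (by omega)) s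
    refine ⟨s :: l, ⟨by simp [h1], List.pairwise_cons.2 ⟨h4, h2⟩, ?_⟩, ?_, h5⟩
    · simpa using ⟨hs, h3⟩
    · simp only [List.mem_cons, forall_eq_or_imp]
      exact ⟨by omega, fun u hu => by have := h4 u hu; omega⟩

/-- Instances of the `n`-th jump as iterated limits. -/
lemma exists_iterated_limit (P : Problem) (n : ℕ) :
    ∃ (g : (P.iterJump n).dom → Baire) (a : (P.iterJump n).dom → ℕ × List ℕ → ℕ),
      UComp (fun x => x.1) a ∧ ∀ x, g x ∈ P.dom ∧ P.sol (g x) ⊆ (P.iterJump n).sol x ∧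
        (∀ y, EventuallyIter n fun l => a x (y, l) = g x y) ∧
        ∀ y l, l.length + 1 = n → ∃ i, ∀ᶠ s in atTop, a x (y, l ++ [s]) = i := by
  induction n with
  | zero => exact ⟨fun x => x.1, fun x p => x.1 p.1, UComp.oracle.sub Primrec.fst, fun x =>
      ⟨x.2, le_rfl, fun y => rfl, fun y l h => by omega⟩⟩
  | succ n ih =>
    obtain ⟨g, a, ha, h⟩ := ih
    choose f i hx r hr b hb hlim using fun x : (P.iterJump (n + 1)).dom => x.2
    have h0 : UComp (fun x : (P.iterJump (n + 1)).dom => x.1) fun x => join (f x) (ofNum (i x)) :=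
      UComp.oracle.congr fun x m => by conv_lhs => rw [hx x]
    have hb' : UComp (fun x : (P.iterJump (n + 1)).dom => x.1) b :=
      .of_computes h0.left (h0.right.apply 0) hb
    let ξ : (P.iterJump (n + 1)).dom → (P.iterJump n).dom := fun x => ⟨r x, hr x⟩
    -- The outermost jump is the innermost limit: the instance below it is approximated in a new
    -- stage, which becomes the last entry of the list.
    obtain ⟨A, hA, hA'⟩ := UComp.exists_limit (a := fun x (p : ℕ × ℕ) => b x (Nat.pair p.1 p.2))
      (hb'.sub (Primrec₂.natPair.comp Primrec.fst Primrec.snd)) (ha.restrict ξ)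
    have hAx : ∀ x y l, ∀ᶠ s in atTop, A x ((y, l), s) = a (ξ x) (y, l) :=
      fun x y l => hA' x (hlim x) (y, l)
    have hrev : Primrec fun p : ℕ × List ℕ => p.2.reverse :=
      Primrec.list_reverse.comp Primrec.snd
    refine ⟨fun x => g (ξ x),
      fun x p => A x ((p.1, p.2.reverse.tail.reverse), p.2.reverse.headI), hA.sub
        (Primrec.pair (Primrec.pair Primrec.fst
          (Primrec.list_reverse.comp (Primrec.list_tail.comp hrev)))
          (Primrec.list_headI.comp hrev)), fun x => ⟨(h (ξ x)).1, ?_, fun y => ?_, fun y l _ => ?_⟩⟩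
    · exact fun z hz => ⟨f x, i x, hx x, r x, hr x, ⟨b x, hb x, hlim x⟩, (h (ξ x)).2.1 hz⟩
    · refine (((h (ξ x)).2.2.1 y).mono fun l hl => ?_).snoc
      filter_upwards [hAx x y l] with s hs
      simpa [hl] using hs
    -- This limit exists for every `l`, not only for large ones, because `a` is total on the limit
    -- instance. Stability of the coloring rests on it.
    · refine ⟨a (ξ x) (y, l), ?_⟩
      filter_upwards [hAx x y l] with s hs
      simpa using hs

/-! ### The coloring -/

lemma latch_congr {u v : ℕ → ℕ} {N : ℕ} (h : ∀ x ≤ N, u x = v x) : latch u N = latch v N := by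
  induction N with
  | zero => exact h 0 le_rfl
  | succ N ih => simp only [latch, ih fun x hx => h x (by omega), h (N + 1) le_rfl]

/-- If `v` enumerates `e < 2`, then `e` is its first value other than `2`. -/
lemma exists_first_of_mem_dom {v : Baire} (hv : v ∈ (C 2).dom) {e : ℕ} (he : e < 2)
    (hmem : e ∈ Set.range v) : ∃ x, v x = e ∧ ∀ y < x, v y = 2 := by
  classical
  have hex : ∃ x, v x ≠ 2 := by
    obtain ⟨x, hx⟩ := hmem
    exact ⟨x, by omega⟩
  obtain ⟨h1, ⟨i, hi, hir⟩, -, -⟩ := hv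
  refine ⟨Nat.find hex, ?_, fun y hy => not_not.1 (Nat.find_min hex hy)⟩
  have h2 := Nat.find_spec hex
  have h3 := h1 (Nat.find hex)
  have h4 : v (Nat.find hex) ≠ i := fun h => hir ⟨_, h⟩
  have h5 : e ≠ i := fun h => hir (h ▸ hmem)
  omega

/-- Finitely many instances of the `n`-th jump of `C 2` can be coded into a coloring of `n`-tuples,
so that the color of any infinite homogeneous set codes solutions. -/
lemma exists_coloring (n : ℕ) :
    ∃ (c : ((C 2).iterJump (n + 1)).star.dom → Baire) (K : ((C 2).iterJump (n + 1)).star.dom → ℕ),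
      UComp (fun x => x.1) c ∧ UComp (fun x => x.1) (fun x (_ : Unit) => K x) ∧ ∀ x, 2 ≤ K x ∧
        IsColoring (n + 1) (K x) (c x) ∧ (2 ≤ n + 1 → IsStable (n + 1) (c x)) ∧
        ∀ H : Set ℕ, H.Infinite → ∀ i, (∀ l ∈ tuples H (n + 1), color (c x) l = i) →
          (finJoin (x.1 0) fun j => ofNum ((Denumerable.ofNat (List ℕ) i).getD j 0)) ∈
            ((C 2).iterJump (n + 1)).star.sol x.1 := by
  classical
  obtain ⟨g, a, ha, hga⟩ := exists_iterated_limit (C 2) (n + 1)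
  choose k hk fs hfs hx using fun x : ((C 2).iterJump (n + 1)).star.dom => x.2
  let o : ((C 2).iterJump (n + 1)).star.dom → Baire := fun x => x.1
  have hxk : ∀ x, x.1 0 = k x := fun x => by
    conv_lhs => rw [hx x, finJoin_zero]
  have hkc : UComp o fun x (_ : Unit) => k x :=
    ((UComp.oracle (o := o)).apply 0).congr fun x _ => hxk x
  -- Indices `j ≥ k x` are sent to instance `0`, which exists since `k x ≥ 1`, so that the
  -- approximations are total in `j`.
  let ξ : ((C 2).iterJump (n + 1)).star.dom → ℕ → ((C 2).iterJump (n + 1)).dom :=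
    fun x j => if h : j < k x then ⟨fs x ⟨j, h⟩, hfs x _⟩ else ⟨fs x ⟨0, hk x⟩, hfs x _⟩
  let F : ((C 2).iterJump (n + 1)).star.dom → ℕ × ℕ → ℕ := fun x p =>
    if p.1 < k x then x.1 (2 * Nat.pair p.1 p.2 + 1) else x.1 (2 * Nat.pair 0 p.2 + 1)
  have hF : UComp o F := by
    refine (UComp.ite (.lt (.of_primrec Primrec.fst) (hkc.sub (Primrec.const ())))
      (UComp.oracle.sub (Primrec.nat_double_succ.comp (Primrec₂.natPair.comp
        Primrec.fst Primrec.snd))) (UComp.oracle.sub (Primrec.nat_double_succ.comp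
        (Primrec₂.natPair.comp (Primrec.const 0) Primrec.snd)))).congr fun x p => ?_
    simp only [F, o]
  have hξ : ∀ x j m, (ξ x j).1 m = F x (j, m) := by
    intro x j m
    have hval : ∀ j m (h : j < k x), x.1 (2 * Nat.pair j m + 1) = fs x ⟨j, h⟩ m := by
      intro j m h
      conv_lhs => rw [hx x, finJoin_odd, dif_pos h]
    by_cases h : j < k x
    · simp only [ξ, F, dif_pos h, if_pos h, hval j m h]
    · simp only [ξ, F, dif_neg h, if_neg h, hval 0 m (hk x)]
  have haξ : UComp o fun x (p : ℕ × ℕ × List ℕ) => a (ξ x p.1) p.2 := ha.trans_param hF ξ hξ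
  -- The head of the tuple bounds the part of the enumeration inspected. If nothing has appeared,
  -- truncated subtraction gives `1 - 2 = 0`, a harmless guess.
  let d : ((C 2).iterJump (n + 1)).star.dom → ℕ → List ℕ → ℕ :=
    fun x j l => 1 - latch (fun y => a (ξ x j) (y, l)) l.headI
  have hd : UComp o fun x (p : ℕ × List ℕ) => d x p.1 p.2 := by
    have h1 : UComp o fun x (q : (ℕ × List ℕ) × ℕ) => a (ξ x q.1.1) (q.2, q.1.2) :=
      haξ.sub (h := fun q : (ℕ × List ℕ) × ℕ => (q.1.1, q.2, q.1.2)) (Primrec.pair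
        (Primrec.fst.comp Primrec.fst) (Primrec.pair Primrec.snd (Primrec.snd.comp Primrec.fst)))
    exact UComp.map (h := fun y : ℕ => 1 - y) (Primrec.nat_sub.comp (Primrec.const 1) Primrec.id)
      (h1.latched.sub (h := fun p : ℕ × List ℕ => (p, p.2.headI)) (Primrec.pair Primrec.id
        (Primrec.list_headI.comp Primrec.snd)))
  let L : ((C 2).iterJump (n + 1)).star.dom → List ℕ → List ℕ :=
    fun x l => (List.range (k x)).map fun j => d x j l
  have hL : UComp o L := by
    have h1 := (hd.sub (h := fun q : List ℕ × ℕ => (q.2, q.1))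
      (Primrec.pair Primrec.snd Primrec.fst)).list
    exact h1.comp ((UComp.of_primrec Primrec.id).pair (hkc.sub (Primrec.const ())))
  have hLlt : ∀ x l, Encodable.encode (L x l) ≤ Encodable.encode (List.replicate (k x) 1) := by
    refine fun x l => encode_le_replicate (by simp [L]) fun u hu => ?_
    obtain ⟨j, -, rfl⟩ := List.mem_map.1 hu
    exact Nat.sub_le _ _
  have hcolor : ∀ x l, color (fun m => Encodable.encode (L x (Denumerable.ofNat (List ℕ) m))) l =
      Encodable.encode (L x l) := fun x l => by simp [color]
  refine ⟨fun x m => Encodable.encode (L x (Denumerable.ofNat (List ℕ) m)),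
    -- The all-ones list has the largest code among lists of `k x` bits.
    fun x => Encodable.encode (List.replicate (k x) 1) + 1,
    UComp.map Primrec.encode (hL.sub (Primrec.ofNat (List ℕ))), ?_,
    fun x => ⟨?_, fun l _ => ?_, fun hn l hl => ?_, fun H hH i hi => ?_⟩⟩
  · have hrep : Primrec fun k : ℕ => Encodable.encode (List.replicate k 1) + 1 := by
      refine (Primrec.succ.comp (Primrec.encode.comp (Primrec.list_map (f := List.range)
        (g := fun _ _ => 1) Primrec.list_range (Primrec₂.const 1)))).of_eq fun k => ?_
      simp [List.map_const']
    exact hkc.map (h := fun k => Encodable.encode (List.replicate k 1) + 1) hrep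
  · obtain ⟨m, hm⟩ := Nat.exists_eq_succ_of_ne_zero (Nat.one_le_iff_ne_zero.1 (hk x))
    change 2 ≤ Encodable.encode (List.replicate (k x) 1) + 1
    rw [hm, Nat.succ_eq_add_one, List.replicate_succ, Encodable.encode_list_cons]
    omega
  · rw [hcolor]
    exact Nat.lt_succ_of_le (hLlt x l)
  · simp only [hcolor]
    have hlen : l.length = n := by simpa using hl.1
    choose α hα using fun j y => (hga (ξ x j)).2.2.2 y l (by omega)
    have hev : ∀ᶠ s in atTop, ∀ p ∈ (Set.Iio (k x) ×ˢ Set.Iic l.headI : Set (ℕ × ℕ)),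
        a (ξ x p.1) (p.2, l ++ [s]) = α p.1 p.2 :=
      (eventually_all_finite ((Set.finite_Iio _).prod (Set.finite_Iic _))).2
        fun p _ => hα p.1 p.2
    -- As `l` is nonempty, its head does not change with the last entry. The color then depends on
    -- finitely many values of `a`, each of which converges.
    refine ⟨Encodable.encode ((List.range (k x)).map fun j => 1 - latch (α j) l.headI), ?_⟩
    filter_upwards [hev] with s hs
    congr 1
    refine List.map_congr_left fun j hj => ?_
    have hh : (l ++ [s]).headI = l.headI := by
      cases l with
      | nil => simp at hlen; omega
      | cons => rfl
    simp only [d, hh]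
    rw [latch_congr fun y hy => hs (j, y) ⟨List.mem_range.1 hj, hy⟩]
  · rw [hxk]
    refine ⟨k x, hk x, fs x, hx x, _, fun j => ?_, rfl⟩
    obtain ⟨hg1, hg2, hg3, -⟩ := hga (ξ x j)
    have hξj : (ξ x j).1 = fs x j := by simp [ξ]
    have hbit : ∀ l ∈ tuples H (n + 1), d x j l = (Denumerable.ofNat (List ℕ) i).getD j 0 := by
      intro l hl
      rw [← hi l hl, hcolor, Denumerable.ofNat_encode, List.getD_eq_getElem _ _ (by simp [L])]
      simp [L]
    obtain ⟨l₀, hl₀, -⟩ := (eventuallyIter_of_forall (n := n + 1) (P := fun _ => True)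
      fun _ => trivial).exists_tuple hH
    have hlt : (Denumerable.ofNat (List ℕ) i).getD j 0 < 2 := by
      rw [← hbit l₀ hl₀]
      exact Nat.lt_succ_of_le (Nat.sub_le _ _)
    rw [← hξj]
    refine hg2 ⟨_, hlt, fun hmem => ?_, rfl⟩
    -- If the bit were enumerated, first at `x₀`, then a tuple from `H` with head at least `x₀` and
    -- correct approximations up to `x₀` would receive the opposite bit.
    obtain ⟨x₀, h1, h2⟩ := exists_first_of_mem_dom hg1 hlt hmem
    obtain ⟨l, hl, hl1, hl2⟩ := ((EventuallyIter.forall_le hg3 x₀).and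
      (eventuallyIter_le_head n x₀)).exists_tuple hH
    have h3 : latch (fun y => a (ξ x j) (y, l)) x₀ = (Denumerable.ofNat (List ℕ) i).getD j 0 := by
      rw [latch_eq fun t ht => by rw [hl1 t ht.le, h2 t ht], hl1 x₀ le_rfl, h1]
    have h4 := latch_persist (u := fun y => a (ξ x j) (y, l)) (s := x₀) (by omega) hl2
    have h5 := hbit l hl
    simp only [d, h4, h3] at h5
    omega

/-- The lower bound for the first-order part of Ramsey's theorem and its restrictions. -/
lemma star_iterJump_le (n : ℕ) {P : ℕ → Problem} (hsol : ∀ k, (P k).sol = (RT (n + 1) k).sol)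
    (hdom : ∀ k c, IsColoring (n + 1) k c → (2 ≤ n + 1 → IsStable (n + 1) c) → c ∈ (P k).dom) :
    WeihrauchLE ((C 2).iterJump (n + 1)).star (Problem.joinFrom 2 P).firstOrderPart := by
  obtain ⟨c, K, hc, hK, h⟩ := exists_coloring n
  let p : ((C 2).iterJump (n + 1)).star.dom → Baire := fun x => join (ofNum (K x)) (c x)
  have hp : ∀ x, p x ∈ (Problem.joinFrom 2 P).dom := fun x =>
    ⟨K x, (h x).1, c x, hdom _ _ (h x).2.1 (h x).2.2.1, rfl⟩
  obtain ⟨Φ, hΦ⟩ := (hK.ofNum.prod hc).exists_index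
  let Y := {y : ((C 2).iterJump (n + 1)).star.dom × Baire //
    y.2 ∈ (Problem.joinFrom 2 P).sol (p y.1)}
  have hY : ∀ y : Y, ∃ H : Set ℕ, H.Infinite ∧ IsHomogeneous (n + 1) (c y.1.1) H ∧
      y.1.2 = join (ofNum (K y.1.1)) (charFn H) := by
    rintro ⟨⟨x, g⟩, k, -, f, -, he, g', hg', hg⟩
    obtain ⟨e1, rfl⟩ := join_inj he
    obtain rfl := ofNum_inj e1
    rw [hsol] at hg'
    obtain ⟨H, h1, h2, rfl⟩ := hg'
    exact ⟨H, h1, h2, hg⟩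
  choose H hinf hhom hHg using hY
  let o : Y → Baire := fun y => join y.1.1.1 y.1.2
  have hH : UPred o fun y z => z ∈ H y := by
    have h1 : UComp o fun y => charFn (H y) := UComp.right (f := fun y => ofNum (K y.1.1))
      (UComp.join_right.congr fun y m => by rw [hHg y])
    exact (UPred.eq h1 (.const 1)).congr fun y z => by simp [charFn]
  -- The color of any one tuple from `H` is the color of `H`, so the first tuple found suffices and
  -- the answer is a number.
  obtain ⟨m, hm, hms⟩ := UComp.exists_find
    (P := fun y (q : ℕ × ℕ) => Denumerable.ofNat (List ℕ) q.2 ∈ tuples (H y) (n + 1))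
    ((hH.mem_tuples (n + 1)).sub ((Primrec.ofNat (List ℕ)).comp Primrec.snd)) (fun y _ => by
      obtain ⟨l, hl, -⟩ := (eventuallyIter_of_forall (n := n + 1) (P := fun _ => True)
        fun _ => trivial).exists_tuple (hinf y)
      exact ⟨Encodable.encode l, by simpa using hl⟩)
  obtain ⟨Ψ, hΨ⟩ := ((UComp.join_left.trans (hc.restrict fun y : Y => y.1.1)).comp hm).exists_index
  refine weihrauchLE_iff.2 ⟨fun x => join x.1 (join (ofNum Φ) (ofNum Ψ)),
    UComp.oracle.prod ((UComp.const _).ofNum.prod (UComp.const _).ofNum), fun x =>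
    ⟨x.1, Φ, Ψ, rfl, p x, hp x, hΦ x, fun g hg =>
      Part.dom_iff_mem.2 ⟨_, hΨ ⟨(x, g), hg⟩ 0⟩⟩,
    fun y => finJoin (y.1.1.1 0) fun j => ofNum ((Denumerable.ofNat (List ℕ) (y.1.2 0)).getD j 0),
    ?_, ?_⟩
  · have h1 : UComp (fun y : {y : ((C 2).iterJump (n + 1)).star.dom × Baire //
        y.2 ∈ (Problem.joinFrom 2 P).firstOrderPart.sol (join y.1.1 (join (ofNum Φ) (ofNum Ψ)))} =>
        join y.1.1.1 y.1.2) fun y (q : ℕ × ℕ) =>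
        if q.2 = 0 then (Denumerable.ofNat (List ℕ) (y.1.2 0)).getD q.1 0 else 0 := by
      classical
      refine (UComp.ite (P := fun _ (q : ℕ × ℕ) => q.2 = 0) (.of_primrec (Primrec.eq.comp
        Primrec.snd (Primrec.const 0))) (UComp.map₂ (Primrec.list_getD 0)
          (UComp.map (Primrec.ofNat (List ℕ)) (UComp.join_right.apply 0))
          (.of_primrec Primrec.fst)) (.const 0)).congr fun y q => by congr
    exact (UComp.finJoin (UComp.join_left.apply 0) h1).congr fun y q => rfl
  · rintro ⟨⟨x, z⟩, f₁, Φ₁, Ψ₁, he, p₁, hp₁, hc₁, g, hg, y, hy, hz⟩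
    obtain rfl : z = ofNum y := hz
    obtain ⟨rfl, he'⟩ := join_inj he
    obtain ⟨e1, e2⟩ := join_inj he'
    obtain rfl := ofNum_inj e1
    obtain rfl := ofNum_inj e2
    obtain rfl := hc₁.unique (hΦ x)
    obtain rfl := functional_unique hy (hΨ ⟨(x, g), hg⟩ 0)
    obtain ⟨i, hi⟩ := hhom ⟨(x, g), hg⟩
    have hci : c x (m ⟨(x, g), hg⟩ 0) = i := by
      rw [← hi _ (hms ⟨(x, g), hg⟩ 0).1]
      simp [color]
    simp only [ofNum_zero_apply, hci]
    exact (h x).2.2.2 _ (hinf ⟨(x, g), hg⟩) i hi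

lemma star_iterJump_le_sRTPlus (n : ℕ) (hn : 2 ≤ n + 1) :
    WeihrauchLE ((C 2).iterJump (n + 1)).star (SRTPlus (n + 1)).firstOrderPart :=
  star_iterJump_le n (fun _ => rfl) fun _ _ h h' => ⟨h, h' hn⟩

lemma star_iterJump_le_rTPlus (n : ℕ) :
    WeihrauchLE ((C 2).iterJump (n + 1)).star (RTPlus (n + 1)).firstOrderPart :=
  star_iterJump_le n (fun _ => rfl) fun _ _ h _ => h

end Weihrauch

/-! ### The theorem -/

open Weihrauch in
theorem mainTheorem4 (n : ℕ) (hn : 1 ≤ n) :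
    ((2 ≤ n → WeihrauchLE ((C 2).iterJump n).star (SRTNat n).firstOrderPart) ∧
      WeihrauchLE ((C 2).iterJump n).star (RTNat n).firstOrderPart ∧
      WeihrauchLE (SRTNat n).firstOrderPart (RTNat n).firstOrderPart ∧
      WeihrauchLE (RTNat n).firstOrderPart ((C 2).star.iterJump n)) ∧
    ((2 ≤ n → WeihrauchLE ((C 2).iterJump n).star (SRTPlus n).firstOrderPart) ∧
      WeihrauchLE ((C 2).iterJump n).star (RTPlus n).firstOrderPart ∧
      WeihrauchLE (SRTPlus n).firstOrderPart (RTPlus n).firstOrderPart ∧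
      WeihrauchLE (RTPlus n).firstOrderPart ((C 2).star.iterJump n)) := by
  obtain ⟨n, rfl⟩ : ∃ m, n = m + 1 := ⟨n - 1, by omega⟩
  have hR := firstOrderPart_mono (rTPlus_le_rTNat (n + 1))
  have hS := firstOrderPart_mono (sRTPlus_le_sRTNat (n + 1))
  exact ⟨⟨fun h => (star_iterJump_le_sRTPlus n h).trans hS, (star_iterJump_le_rTPlus n).trans hR,
      firstOrderPart_mono (sRTNat_le _), firstOrderPart_rTNat_le n⟩,
    star_iterJump_le_sRTPlus n, star_iterJump_le_rTPlus n,
    firstOrderPart_mono (sRTPlus_le _), hR.trans (firstOrderPart_rTNat_le n)⟩
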